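/- Let $\Delta\ge 3$ be an integer. All graphs are finite, simple and undirected. A matching $M$ in a graph $G$ is *uniquely restricted* if no matching $M'\ne M$ of $G$ covers exactly the same set of vertices as $M$, and $\nu_{ur}(G)$ denotes the maximum size of a uniquely restricted matching in $G$. Then there is a polynomial-time algorithm that, given a connected bipartite graph $G$ of maximum degree at most $\Delta$ containing no cycle of length $4$, finds a uniquely restricted matching $M$ of $G$ of size $$|M|\ \ge\ \frac{(\Delta-1)^2+(\Delta-2)}{(\Delta-1)^3+(\Delta-2)}\,\nu_{ur}(G).$$ Here $G$ is given by its adjacency matrix on vertices $0,\dots,n-1$, and polynomial time means that a random access machine with addition, truncated subtraction and comparison of natural numbers (and no multiplication) performs a number of elementary operations that is at most a polynomial in the number $n$ of vertices of $G$. -/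

import Mathlib

/-! ### Uniquely restricted matchings -/

namespace SimpleGraph

/-- A matching `M` of `G` is *uniquely restricted* if no other matching of `G` covers exactly the
same set of vertices. (For a matching, presented as a subgraph with `Subgraph.IsMatching`, the
vertex set `M.verts` is the set of vertices incident with an edge of `M`.) -/
def IsUniquelyRestricted {V : Type*} {G : SimpleGraph V} (M : G.Subgraph) : Prop :=
  M.IsMatching ∧ ∀ M' : G.Subgraph, M'.IsMatching → M'.verts = M.verts → M' = M

/-- The uniquely restricted matching number of a finite graph: the maximum number of edges of a
uniquely restricted matching. -/
noncomputable def urMatchingNumber {V : Type*} [Finite V] (G : SimpleGraph V) : ℕ :=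
  sSup {k | ∃ M : G.Subgraph, IsUniquelyRestricted M ∧ M.edgeSet.ncard = k}

end SimpleGraph

/-! ### Random access machines

Structured programs for a random access machine. The memory holds natural numbers, in scalar
variables and in unbounded two-dimensional arrays. The arithmetic is addition, truncated
subtraction and comparison. There is no multiplication: an elementary operation lengthens the
longest number in memory by at most one bit, so that the number of elementary operations is
polynomially related to running time on a Turing machine. -/

namespace RAM

/-- A memory state: the values of the scalar variables and of the array entries. -/
structure State where
  /-- The value of a scalar variable. -/
  var : ℕ → ℕ
  /-- `arr a i j` is the entry in row `i` and column `j` of the array `a`. -/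
  arr : ℕ → ℕ → ℕ → ℕ

/-- Write a scalar variable. -/
def State.setVar (s : State) (x v : ℕ) : State :=
  { s with var := fun y => if y = x then v else s.var y }

/-- Write an array entry. -/
def State.setArr (s : State) (a i j v : ℕ) : State :=
  { s with arr := fun b k l => if b = a ∧ k = i ∧ l = j then v else s.arr b k l }

/-- Expressions. -/
inductive Expr where
  | const (c : ℕ)
  | var (x : ℕ)
  | get (a : ℕ) (i j : Expr)
  | add (e f : Expr)
  | sub (e f : Expr)
  | lt (e f : Expr)
  | eq (e f : Expr)

/-- The value of an expression; comparisons return `1` (true) or `0` (false). -/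
def Expr.eval (s : State) : Expr → ℕ
  | const c => c
  | var x => s.var x
  | get a i j => s.arr a (i.eval s) (j.eval s)
  | add e f => e.eval s + f.eval s
  | sub e f => e.eval s - f.eval s
  | lt e f => if e.eval s < f.eval s then 1 else 0
  | eq e f => if e.eval s = f.eval s then 1 else 0

/-- The number of elementary operations in the evaluation of an expression. -/
def Expr.cost : Expr → ℕ
  | const _ => 1
  | var _ => 1
  | get _ i j => i.cost + j.cost + 1
  | add e f => e.cost + f.cost + 1
  | sub e f => e.cost + f.cost + 1
  | lt e f => e.cost + f.cost + 1
  | eq e f => e.cost + f.cost + 1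

/-- Programs. In tests, a nonzero value counts as true. -/
inductive Prog where
  | skip
  | assign (x : ℕ) (e : Expr)
  | put (a : ℕ) (i j e : Expr)
  | seq (p q : Prog)
  | cond (e : Expr) (p q : Prog)
  | loop (e : Expr) (p : Prog)

/-- `Exec p s t s'`: started in the memory state `s`, the program `p` terminates after exactly `t`
elementary operations, in the memory state `s'`. -/
inductive Exec : Prog → State → ℕ → State → Prop where
  | skip (s : State) : Exec Prog.skip s 1 s
  | assign (s : State) (x : ℕ) (e : Expr) :
      Exec (Prog.assign x e) s (e.cost + 1) (s.setVar x (e.eval s))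
  | put (s : State) (a : ℕ) (i j e : Expr) :
      Exec (Prog.put a i j e) s (i.cost + j.cost + e.cost + 1)
        (s.setArr a (i.eval s) (j.eval s) (e.eval s))
  | seq {p q : Prog} {s s₁ s₂ : State} {t₁ t₂ : ℕ} :
      Exec p s t₁ s₁ → Exec q s₁ t₂ s₂ → Exec (Prog.seq p q) s (t₁ + t₂) s₂
  | condTrue {e : Expr} {p q : Prog} {s s₁ : State} {t : ℕ} :
      e.eval s ≠ 0 → Exec p s t s₁ → Exec (Prog.cond e p q) s (e.cost + 1 + t) s₁
  | condFalse {e : Expr} {p q : Prog} {s s₁ : State} {t : ℕ} :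
      e.eval s = 0 → Exec q s t s₁ → Exec (Prog.cond e p q) s (e.cost + 1 + t) s₁
  | loopTrue {e : Expr} {p : Prog} {s s₁ s₂ : State} {t₁ t₂ : ℕ} :
      e.eval s ≠ 0 → Exec p s t₁ s₁ → Exec (Prog.loop e p) s₁ t₂ s₂ →
      Exec (Prog.loop e p) s (e.cost + 1 + t₁ + t₂) s₂
  | loopFalse {e : Expr} {p : Prog} {s : State} :
      e.eval s = 0 → Exec (Prog.loop e p) s (e.cost + 1) s

/-- The initial memory state for an input graph with vertices `0, …, n - 1`: variable `0` holds the
number `n` of vertices, array `0` holds the adjacency matrix, and everything else is `0`. -/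
def inputState {n : ℕ} (G : SimpleGraph (Fin n)) [DecidableRel G.Adj] : State where
  var := fun x => if x = 0 then n else 0
  arr := fun a i j =>
    if h : a = 0 ∧ i < n ∧ j < n then
      if G.Adj ⟨i, h.2.1⟩ ⟨j, h.2.2⟩ then 1 else 0
    else 0

/-- In the memory state `s`, the first `n` rows and columns of array `1` hold the adjacency matrix
of the subgraph `M`, that is, the set of edges of `M`. -/
def State.Outputs {n : ℕ} {G : SimpleGraph (Fin n)} (s : State) (M : G.Subgraph) : Prop :=
  ∀ i j : Fin n, (M.Adj i j → s.arr 1 i j = 1) ∧ (¬ M.Adj i j → s.arr 1 i j = 0)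

end RAM

/-!
The algorithm is a one-sided greedy procedure. Let `B` be the part of the bipartition that contains
the vertex `0`. As long as possible, pick a vertex `b ∈ B` with a positive number of uncovered
neighbours, as few as possible, match it with one of them, and cover all neighbours of `b`. The
partner of a pick is not adjacent to any earlier pick, so that the adjacency matrix between picks and
partners is triangular and the matching is uniquely restricted
(`IsGreedyRun.isUniquelyRestricted`).

Let `d = Δ - 1`, let `p` be the number of picks, and let `p₁` be the number of picks with exactly one
uncovered neighbour. The uniquely restricted matching number `ν` is bounded in two ways.

* By connectivity, after the first pick there is always a vertex of `B` with both a covered and an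
  uncovered neighbour, so that a pick covers at most `d` new vertices. All neighbours of `B` get
  covered, whence `ν + (d - 1) p₁ ≤ d p`. The first pick covers `d + 1` vertices only if all vertices
  of `B` have degree `d + 1`. In this case a uniquely restricted matching misses at least `d` vertices
  of the other part (`urMatchingNumber_add_le_ncard`), since one of its vertices in `B` has only one
  matched neighbour, and this more than makes up for the additional vertex.
* Without 4-cycles, a vertex of `B` that is not picked loses its uncovered neighbours one at a time.
  While it has exactly one, only vertices with one uncovered neighbour are picked, and such a pick
  exhausts at most `d` other vertices. Hence `ν ≤ |B| ≤ p + d p₁`.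

Eliminating `p₁` gives `(2d - 1) ν ≤ (d² + d - 1) p` (`IsGreedyRun.mul_urMatchingNumber_le`), and
`(2d - 1) / (d² + d - 1) ≥ (d² + d - 1) / (d³ + d - 1)`.

The program does not depend on `Δ`. It finds `B` by `n` rounds of marking the vertices at distance two
from a marked one, and then tries `n` times to pick a vertex. Its correctness and running time are
derived from an invariant rule for bounded loops (`RAM.Runs.forLoop`).
-/

/-! ### Uniquely restricted matchings in bipartite graphs -/

namespace SimpleGraph

variable {V : Type*} {G : SimpleGraph V} {B : Set V}

/-- A self-map of a finite type that preserves a nonempty set permutes a nonempty subset of it, the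
set of its periodic points. -/
theorem exists_bijOn_of_mapsTo [Finite V] {f : V → V} {X : Set V} (hf : Set.MapsTo f X X)
    (hX : X.Nonempty) : ∃ P ⊆ X, P.Nonempty ∧ Set.BijOn f P P := by
  refine ⟨X ∩ Function.periodicPts f, Set.inter_subset_left, ?_, ?_, ?_, ?_⟩
  · obtain ⟨x, hx⟩ := hX
    obtain ⟨m, n, hmn, h⟩ := Finite.exists_ne_map_eq_of_infinite (fun k : ℕ => f^[k] x)
    wlog hlt : m < n generalizing m n
    · exact this n m hmn.symm h.symm (by omega)
    refine ⟨f^[m] x, hf.iterate m hx, Function.mk_mem_periodicPts (n := n - m) (by omega) ?_⟩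
    change f^[n - m] (f^[m] x) = f^[m] x
    rw [← Function.iterate_add_apply, Nat.sub_add_cancel hlt.le]
    exact h.symm
  · exact fun x hx => ⟨hf hx.1, (Function.bijOn_periodicPts f).mapsTo hx.2⟩
  · exact (Function.bijOn_periodicPts f).injOn.mono Set.inter_subset_right
  · rintro x ⟨hx, hp⟩
    obtain ⟨k, hk, hkx⟩ := hp
    refine ⟨f^[k - 1] x, ⟨hf.iterate _ hx, ?_⟩, ?_⟩
    · exact ((Function.bijOn_periodicPts f).mapsTo.iterate _) ⟨k, hk, hkx⟩
    · rw [← Function.iterate_succ_apply' f, Nat.succ_eq_add_one, Nat.sub_add_cancel hk]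
      exact hkx

/-- If every matched vertex of `B` had a matched neighbour other than its partner, then these second
neighbours would lead around an alternating cycle, and switching along it would give another
matching of the same vertices. -/
theorem IsUniquelyRestricted.exists_forall_adj [Finite V]
    (hB : ∀ u v, G.Adj u v → (u ∈ B ↔ v ∉ B)) {M : G.Subgraph} (hM : IsUniquelyRestricted M)
    (hne : (B ∩ M.verts).Nonempty) :
    ∃ b ∈ B ∩ M.verts, ∀ a ∈ M.verts, G.Adj b a → M.Adj b a := by
  classical
  by_contra! hcon
  have hmate : ∀ v, ∃ w, v ∈ M.verts → M.Adj v w := fun v => by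
    by_cases hv : v ∈ M.verts
    · obtain ⟨w, hw, -⟩ := hM.1 hv
      exact ⟨w, fun _ => hw⟩
    · exact ⟨v, fun h => absurd h hv⟩
  choose mate hmate using hmate
  have huniq : ∀ {u v w}, M.Adj u v → M.Adj u w → v = w := fun {u v w} h1 h2 =>
    (hM.1 (M.edge_vert h1)).unique h1 h2
  have hf : ∀ b, ∃ a, b ∈ B ∩ M.verts → a ∈ M.verts ∧ G.Adj b a ∧ ¬ M.Adj b a := fun b => by
    by_cases hb : b ∈ B ∩ M.verts
    · obtain ⟨a, h⟩ := hcon b hb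
      exact ⟨a, fun _ => h⟩
    · exact ⟨b, fun h => absurd h hb⟩
  choose f hf using hf
  have hmB : ∀ {v}, v ∈ M.verts → v ∉ B → mate v ∈ B ∩ M.verts := fun {v} hv hvB =>
    ⟨(hB _ _ (M.adj_sub (hmate v hv)).symm).2 hvB, M.edge_vert (hmate v hv).symm⟩
  have hfB : ∀ {b}, b ∈ B ∩ M.verts → f b ∉ B := fun {b} hb => (hB _ _ (hf b hb).2.1).1 hb.1
  have hmm : ∀ {v}, v ∈ M.verts → mate (mate v) = v := fun {v} hv =>
    huniq (hmate _ (M.edge_vert (hmate v hv).symm)) (hmate v hv).symm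
  obtain ⟨P, hPX, ⟨p, hp⟩, hP⟩ := exists_bijOn_of_mapsTo (f := fun b => mate (f b))
    (X := B ∩ M.verts) (fun b hb => hmB (hf b hb).1 (hfB hb)) hne
  -- The switched matching, as a map from the matched vertices of `B` to their new partners.
  let g : V → V := fun b => if b ∈ P then f b else mate b
  have hg : ∀ {b}, b ∈ B ∩ M.verts → G.Adj b (g b) ∧ g b ∈ M.verts ∧ g b ∉ B := fun {b} hb => by
    by_cases h : b ∈ P
    · simp only [g, h, if_true]
      exact ⟨(hf b hb).2.1, (hf b hb).1, hfB hb⟩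
    · simp only [g, h, if_false]
      have := hmate b hb.2
      exact ⟨M.adj_sub this, M.edge_vert this.symm, (hB _ _ (M.adj_sub this)).1 hb.1⟩
  have hgbij : ∀ a ∈ M.verts, a ∉ B → ∃! b, b ∈ B ∩ M.verts ∧ g b = a := by
    intro a ha haB
    have hc := hmB ha haB
    by_cases hcP : mate a ∈ P
    · obtain ⟨b, hb, hba⟩ := hP.surjOn hcP
      have hba : mate (f b) = mate a := hba
      have hfa : f b = a := by rw [← hmm (hf b (hPX hb)).1, hba, hmm ha]
      refine ⟨b, ⟨hPX hb, by simp [g, hb, hfa]⟩, ?_⟩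
      rintro b' ⟨hb', hga⟩
      by_cases h : b' ∈ P
      · simp only [g, h, if_true] at hga
        exact hP.injOn h hb (show mate (f b') = mate (f b) by rw [hga, hfa])
      · simp only [g, h, if_false] at hga
        exact absurd (by rwa [← hga, hmm hb'.2] at hcP) h
    · refine ⟨mate a, ⟨hc, by simp [g, hcP, hmm ha]⟩, ?_⟩
      rintro b' ⟨hb', hga⟩
      by_cases h : b' ∈ P
      · simp only [g, h, if_true] at hga
        exact absurd (by rw [← hga]; exact hP.mapsTo h) hcP
      · simp only [g, h, if_false] at hga
        rw [← hga, hmm hb'.2]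
  let M' : G.Subgraph :=
    { verts := M.verts
      Adj := fun u v => (u ∈ B ∩ M.verts ∧ g u = v) ∨ (v ∈ B ∩ M.verts ∧ g v = u)
      adj_sub := by
        rintro u v (⟨h, rfl⟩ | ⟨h, rfl⟩)
        exacts [(hg h).1, (hg h).1.symm]
      edge_vert := by
        rintro u v (⟨h, rfl⟩ | ⟨h, rfl⟩)
        exacts [h.2, (hg h).2.1]
      symm := ⟨fun u v h => h.symm⟩ }
  have hM' : M'.IsMatching := by
    intro v hv
    have hv : v ∈ M.verts := hv
    by_cases hvB : v ∈ B
    · refine ⟨g v, Or.inl ⟨⟨hvB, hv⟩, rfl⟩, ?_⟩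
      rintro w (⟨-, h⟩ | ⟨h, rfl⟩)
      exacts [h.symm, absurd hvB (hg h).2.2]
    · obtain ⟨b, hb, hu⟩ := hgbij v hv hvB
      refine ⟨b, Or.inr hb, ?_⟩
      rintro w (⟨h, -⟩ | h)
      exacts [absurd h.1 hvB, hu w h]
  have heq : M' = M := hM.2 M' hM' rfl
  have hadj : M'.Adj p (f p) := Or.inl ⟨hPX hp, by simp [g, hp]⟩
  rw [heq] at hadj
  exact (hf p (hPX hp)).2.2 hadj

/-- In a bipartite graph a matching has as many edges as covered vertices in the part `B`. -/
theorem Subgraph.IsMatching.ncard_edgeSet_le [Finite V]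
    (hB : ∀ u v, G.Adj u v → (u ∈ B ↔ v ∉ B)) {M : G.Subgraph} (hM : M.IsMatching) :
    M.edgeSet.ncard ≤ (B ∩ M.verts).ncard := by
  classical
  have hmate : ∀ v, ∃ w, v ∈ M.verts → ∀ w', M.Adj v w' → w' = w := fun v => by
    by_cases hv : v ∈ M.verts
    · obtain ⟨w, -, hw⟩ := hM hv
      exact ⟨w, fun _ => hw⟩
    · exact ⟨v, fun h => absurd h hv⟩
  choose mate hmate using hmate
  have hsub : M.edgeSet ⊆ (fun b => s(b, mate b)) '' (B ∩ M.verts) := by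
    intro e
    induction e with | _ u v
    intro h
    have h : M.Adj u v := h
    by_cases hu : u ∈ B
    · exact ⟨u, ⟨hu, M.edge_vert h⟩, by simp [← hmate u (M.edge_vert h) v h]⟩
    · have hv : v ∈ B := (hB _ _ (M.adj_sub h).symm).2 hu
      refine ⟨v, ⟨hv, M.edge_vert h.symm⟩, ?_⟩
      simp [← hmate v (M.edge_vert h.symm) u h.symm, Sym2.eq_swap]
  exact (Set.ncard_le_ncard hsub (Set.toFinite _)).trans (Set.ncard_image_le (Set.toFinite _))

theorem urMatchingNumber_le [Finite V] {k : ℕ}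
    (h : ∀ M : G.Subgraph, IsUniquelyRestricted M → M.edgeSet.ncard ≤ k) :
    G.urMatchingNumber ≤ k := by
  refine csSup_le' ?_
  rintro _ ⟨M, hM, rfl⟩
  exact h M hM

theorem urMatchingNumber_le_ncard [Finite V] (hB : ∀ u v, G.Adj u v → (u ∈ B ↔ v ∉ B)) :
    G.urMatchingNumber ≤ B.ncard :=
  urMatchingNumber_le fun _ hM => (hM.1.ncard_edgeSet_le hB).trans
    (Set.ncard_le_ncard Set.inter_subset_left (Set.toFinite _))

/-- The part opposite to `B` bounds the matching number too; isolated vertices need not be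
counted. -/
theorem urMatchingNumber_le_ncard_of_adj [Finite V] (hB : ∀ u v, G.Adj u v → (u ∈ B ↔ v ∉ B))
    {C : Set V} (hC : ∀ b ∈ B, ∀ a, G.Adj b a → a ∈ C) : G.urMatchingNumber ≤ C.ncard := by
  refine urMatchingNumber_le fun M hM => ?_
  have hB' : ∀ u v, G.Adj u v → (u ∈ Bᶜ ↔ v ∉ Bᶜ) := fun u v h => by
    have := hB u v h
    simp only [Set.mem_compl_iff]
    tauto
  refine (hM.1.ncard_edgeSet_le hB').trans (Set.ncard_le_ncard ?_ (Set.toFinite _))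
  rintro a ⟨ha, hv⟩
  obtain ⟨b, hb, -⟩ := hM.1 hv
  have := M.adj_sub hb
  exact hC b ((hB b a this.symm).2 ha) a this.symm

/-- If all vertices of `B` have more than `d` neighbours, then a uniquely restricted matching leaves
at least `d` vertices of the other part uncovered. -/
theorem urMatchingNumber_add_le_ncard [Finite V] (hB : ∀ u v, G.Adj u v → (u ∈ B ↔ v ∉ B))
    {C : Set V} (hC : ∀ b ∈ B, ∀ a, G.Adj b a → a ∈ C) {d : ℕ}
    (hd : ∀ b ∈ B, d < (G.neighborSet b).ncard) (hne : B.Nonempty) :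
    G.urMatchingNumber + d ≤ C.ncard := by
  have hB' : ∀ u v, G.Adj u v → (u ∈ Bᶜ ↔ v ∉ Bᶜ) := fun u v h => by
    have := hB u v h
    simp only [Set.mem_compl_iff]
    tauto
  have hdC : d ≤ C.ncard := by
    obtain ⟨b, hb⟩ := hne
    exact (hd b hb).le.trans (Set.ncard_le_ncard (fun a ha => hC b hb a ha) (Set.toFinite _))
  suffices h : G.urMatchingNumber ≤ C.ncard - d by omega
  refine urMatchingNumber_le fun M hM => ?_
  have h1 := hM.1.ncard_edgeSet_le hB'
  rcases (B ∩ M.verts).eq_empty_or_nonempty with h0 | hne'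
  · have := hM.1.ncard_edgeSet_le hB
    rw [h0, Set.ncard_empty] at this
    omega
  · obtain ⟨b, ⟨hbB, hbM⟩, hb⟩ := hM.exists_forall_adj hB hne'
    obtain ⟨w, hw, hwu⟩ := hM.1 hbM
    have hdisj : Disjoint (Bᶜ ∩ M.verts) (G.neighborSet b \ {w}) := by
      rw [Set.disjoint_left]
      rintro a ⟨-, haM⟩ ⟨hab, haw⟩
      exact haw (hwu a (hb a haM hab))
    have hsub : (Bᶜ ∩ M.verts) ∪ (G.neighborSet b \ {w}) ⊆ C := by
      rintro a (⟨haB, haM⟩ | ⟨hab, -⟩)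
      · obtain ⟨c, hc, -⟩ := hM.1 haM
        have := M.adj_sub hc
        exact hC c ((hB c a this.symm).2 haB) a this.symm
      · exact hC b hbB a hab
    have h2 := Set.ncard_le_ncard hsub (Set.toFinite _)
    rw [Set.ncard_union_eq hdisj (Set.toFinite _) (Set.toFinite _)] at h2
    have h3 := Set.ncard_sdiff_singleton_add_one (s := G.neighborSet b) (a := w)
      (M.adj_sub hw) (Set.toFinite _)
    have := hd b hbB
    omega

theorem eq_of_cycleGraph_four_free (h4 : (cycleGraph 4).Free G) {b c x y : V} (hbc : b ≠ c)
    (hbx : G.Adj b x) (hby : G.Adj b y) (hcx : G.Adj c x) (hcy : G.Adj c y) : x = y := by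
  by_contra hxy
  refine h4 ⟨⟨⟨![b, x, c, y], ?_⟩, ?_⟩⟩
  · intro i j hij
    fin_cases i <;> fin_cases j <;>
      first
        | (exfalso; revert hij; decide)
        | simp [hbx, hby, hcx, hcy, hbx.symm, hby.symm, hcx.symm, hcy.symm]
  · intro i j hij
    fin_cases i <;> fin_cases j <;>
      simp_all [hbx.ne, hby.ne, hcx.ne, hcy.ne, hbx.ne', hby.ne', hcx.ne', hcy.ne']

end SimpleGraph

/-! ### The greedy matching -/

namespace SimpleGraph

variable {V : Type*} [Fintype V] {G : SimpleGraph V} {B : Set V}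

open Classical in
/-- The vertices adjacent to the first component of some pair in the list. -/
noncomputable def covered (G : SimpleGraph V) (L : List (V × V)) : Finset V :=
  {a | ∃ q ∈ L, G.Adj q.1 a}

open Classical in
/-- The neighbours of `b` that are not yet covered. -/
noncomputable def uncovered (G : SimpleGraph V) (L : List (V × V)) (b : V) : Finset V :=
  {a | G.Adj b a ∧ a ∉ G.covered L}

theorem mem_covered {L : List (V × V)} {a : V} : a ∈ G.covered L ↔ ∃ q ∈ L, G.Adj q.1 a := by
  simp [covered]

theorem mem_uncovered {L : List (V × V)} {a b : V} :
    a ∈ G.uncovered L b ↔ G.Adj b a ∧ a ∉ G.covered L := by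
  simp [uncovered]

/-- `IsGreedyRun G B L`: the list `L`, most recent pair first, is the record of a run of the greedy
algorithm. Each step picks a vertex `b ∈ B` whose number of uncovered neighbours is positive and as
small as possible, together with one of these neighbours, and covers all neighbours of `b`. -/
inductive IsGreedyRun (G : SimpleGraph V) (B : Set V) : List (V × V) → Prop
  | nil : IsGreedyRun G B []
  | cons {L : List (V × V)} {b a : V} : IsGreedyRun G B L → b ∈ B → a ∈ G.uncovered L b →
      (∀ c ∈ B, (G.uncovered L c).Nonempty → (G.uncovered L b).card ≤ (G.uncovered L c).card) →
      IsGreedyRun G B ((b, a) :: L)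

theorem IsGreedyRun.mem {L : List (V × V)} (h : G.IsGreedyRun B L) {q : V × V} (hq : q ∈ L) :
    q.1 ∈ B ∧ G.Adj q.1 q.2 := by
  induction h with
  | nil => simp at hq
  | cons _ hb ha _ ih =>
    rcases List.mem_cons.1 hq with rfl | hq
    · exact ⟨hb, (mem_uncovered.1 ha).1⟩
    · exact ih hq

theorem IsGreedyRun.nodup {L : List (V × V)} (h : G.IsGreedyRun B L) : L.Nodup := by
  induction h with
  | nil => simp
  | cons _ _ ha _ ih =>
    refine List.nodup_cons.2 ⟨fun hmem => ?_, ih⟩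
    exact (mem_uncovered.1 ha).2 (mem_covered.2 ⟨_, hmem, (mem_uncovered.1 ha).1⟩)

theorem covered_cons [DecidableEq V] (L : List (V × V)) (b a : V) :
    G.covered ((b, a) :: L) = G.covered L ∪ G.uncovered L b := by
  ext x
  simp only [mem_covered, mem_uncovered, Finset.mem_union, List.mem_cons, exists_eq_or_imp]
  by_cases hx : ∃ q ∈ L, G.Adj q.1 x <;> simp [hx]

theorem card_covered_cons (L : List (V × V)) (b a : V) :
    (G.covered ((b, a) :: L)).card = (G.covered L).card + (G.uncovered L b).card := by
  classical
  rw [covered_cons, Finset.card_union_of_disjoint]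
  rw [Finset.disjoint_left]
  exact fun x hx hx' => (mem_uncovered.1 hx').2 hx

theorem IsGreedyRun.length_le_card_covered {L : List (V × V)} (h : G.IsGreedyRun B L) :
    L.length ≤ (G.covered L).card := by
  induction h with
  | nil => simp
  | cons _ _ ha _ ih =>
    rw [card_covered_cons, List.length_cons]
    have := Finset.card_pos.2 ⟨_, ha⟩
    omega

/-- The matching that consists of the pairs of a greedy run. -/
def IsGreedyRun.matching {L : List (V × V)} (h : G.IsGreedyRun B L) : G.Subgraph where
  verts := {v | ∃ q ∈ L, v = q.1 ∨ v = q.2}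
  Adj u v := (u, v) ∈ L ∨ (v, u) ∈ L
  adj_sub := by
    rintro u v (huv | huv)
    exacts [(h.mem huv).2, (h.mem huv).2.symm]
  edge_vert := by
    rintro u v (huv | huv)
    exacts [⟨_, huv, Or.inl rfl⟩, ⟨_, huv, Or.inr rfl⟩]
  symm := ⟨fun _ _ huv => huv.symm⟩

/-- When a pair `(b, a)` joins a greedy run, `a` is not adjacent to any earlier pick. By induction from
the most recent pair on, a matching of the same vertices therefore has to contain every pair of the
run. Here `K` consists of the pairs already shown to be in the matching. -/
theorem IsGreedyRun.adj_of_isMatching (hB : ∀ u v, G.Adj u v → (u ∈ B ↔ v ∉ B))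
    {K L : List (V × V)} (h : G.IsGreedyRun B (K ++ L)) {M : G.Subgraph} (hM : M.IsMatching)
    (hK : ∀ q ∈ K, M.Adj q.1 q.2)
    (hv : ∀ v, v ∈ M.verts ↔ ∃ q ∈ K ++ L, v = q.1 ∨ v = q.2)
    (hL : G.IsGreedyRun B L) (hKL : ∀ q ∈ K, q.2 ∉ G.covered L) :
    ∀ q ∈ L, M.Adj q.1 q.2 := by
  induction hL generalizing K with
  | nil => simp
  | @cons L b a hL hb ha hmin ih =>
    have hba := (mem_uncovered.1 ha).1
    have haM : a ∈ M.verts := (hv a).2 ⟨(b, a), by simp, Or.inr rfl⟩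
    have hadj : M.Adj b a := by
      obtain ⟨c, hc, -⟩ := hM haM
      have hcB : c ∈ B := by
        have h1 := hB _ _ hba
        have h2 := hB _ _ (M.adj_sub hc)
        tauto
      obtain ⟨q, hq, hcq⟩ := (hv c).1 (M.edge_vert hc.symm)
      have hqB := h.mem hq
      have hcq : c = q.1 := hcq.resolve_right fun h' =>
        (hB _ _ hqB.2).1 hqB.1 (h' ▸ hcB)
      subst hcq
      rcases List.mem_append.1 hq with hq | hq
      · have haq := (hM (M.edge_vert hc.symm)).unique hc.symm (hK q hq)
        refine absurd ?_ (hKL q hq)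
        rw [← haq]
        exact mem_covered.2 ⟨(b, a), by simp, hba⟩
      · rcases List.mem_cons.1 hq with rfl | hq
        · exact hc.symm
        · exact absurd (mem_covered.2 ⟨q, hq, (M.adj_sub hc).symm⟩) (mem_uncovered.1 ha).2
    have hrest : ∀ q ∈ L, M.Adj q.1 q.2 := by
      refine ih (K := K ++ [(b, a)]) (by simpa using h) ?_ (by simpa using hv) ?_
      · intro q hq
        rcases List.mem_append.1 hq with hq | hq
        · exact hK q hq
        · rw [List.mem_singleton.1 hq]
          exact hadj
      · intro q hq
        rcases List.mem_append.1 hq with hq | hq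
        · classical
          intro hcov
          refine hKL q hq ?_
          rw [covered_cons]
          exact Finset.mem_union_left _ hcov
        · rw [List.mem_singleton.1 hq]
          exact (mem_uncovered.1 ha).2
    intro q hq
    rcases List.mem_cons.1 hq with rfl | hq
    · exact hadj
    · exact hrest q hq

theorem IsGreedyRun.isMatching (hB : ∀ u v, G.Adj u v → (u ∈ B ↔ v ∉ B))
    {L : List (V × V)} (h : G.IsGreedyRun B L) : h.matching.IsMatching := by
  have hfst : ∀ {L : List (V × V)}, G.IsGreedyRun B L → ∀ q ∈ L, ∀ q' ∈ L,
      q.1 = q'.1 ∨ q.2 = q'.2 → q = q' := by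
    intro L h
    induction h with
    | nil => simp
    | @cons L b a hL hb ha hmin ih =>
      have hba := mem_uncovered.1 ha
      have key : ∀ q ∈ L, ¬ (b = q.1 ∨ a = q.2) := by
        rintro q hq (rfl | rfl)
        · exact hba.2 (mem_covered.2 ⟨q, hq, hba.1⟩)
        · exact hba.2 (mem_covered.2 ⟨q, hq, (hL.mem hq).2⟩)
      intro q hq q' hq' hqq
      rcases List.mem_cons.1 hq with rfl | hq <;> rcases List.mem_cons.1 hq' with rfl | hq'
      · rfl
      · exact absurd hqq (key q' hq')
      · exact absurd (hqq.imp Eq.symm Eq.symm) (key q hq)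
      · exact ih q hq q' hq' hqq
  rintro v ⟨q, hq, hvq⟩
  have hqB := h.mem hq
  have hq2 := (hB _ _ hqB.2).1 hqB.1
  rcases hvq with rfl | rfl
  · refine ⟨q.2, Or.inl hq, ?_⟩
    rintro w (hw | hw)
    · exact congrArg Prod.snd (hfst h _ hw q hq (Or.inl rfl))
    · exact absurd hqB.1 ((hB _ _ (h.mem hw).2).1 (h.mem hw).1)
  · refine ⟨q.1, Or.inr hq, ?_⟩
    rintro w (hw | hw)
    · exact absurd (h.mem hw).1 hq2
    · exact congrArg Prod.fst (hfst h _ hw q hq (Or.inr rfl))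

theorem IsGreedyRun.isUniquelyRestricted (hB : ∀ u v, G.Adj u v → (u ∈ B ↔ v ∉ B))
    {L : List (V × V)} (h : G.IsGreedyRun B L) : IsUniquelyRestricted h.matching := by
  refine ⟨h.isMatching hB, fun M hM hv => ?_⟩
  have hadj := IsGreedyRun.adj_of_isMatching hB (K := []) h hM (by simp)
    (fun v => by rw [hv]; rfl) h (by simp)
  refine Subgraph.ext hv ?_
  have hle : ∀ u v, h.matching.Adj u v → M.Adj u v := by
    rintro u v (huv | huv)
    exacts [hadj _ huv, (hadj _ huv).symm]
  funext u v
  refine propext ⟨fun huv => ?_, hle u v⟩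
  have hu : u ∈ h.matching.verts := hv ▸ M.edge_vert huv
  obtain ⟨w, hw, -⟩ := h.isMatching hB hu
  rwa [(hM (M.edge_vert huv)).unique huv (hle _ _ hw)]

theorem IsGreedyRun.length_le_ncard_edgeSet (hB : ∀ u v, G.Adj u v → (u ∈ B ↔ v ∉ B))
    {L : List (V × V)} (h : G.IsGreedyRun B L) : L.length ≤ h.matching.edgeSet.ncard := by
  classical
  rw [← List.toFinset_card_of_nodup h.nodup, ← Set.ncard_coe_finset]
  refine Set.ncard_le_ncard_of_injOn (fun q => s(q.1, q.2)) ?_ ?_ (Set.toFinite _)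
  · exact fun q hq => Or.inl (List.mem_toFinset.1 hq)
  · intro q hq q' hq' hqq
    have h1 := h.mem (List.mem_toFinset.1 hq)
    have h2 := h.mem (List.mem_toFinset.1 hq')
    rcases Sym2.eq_iff.1 hqq with ⟨h3, h4⟩ | ⟨h3, h4⟩
    · exact Prod.ext h3 h4
    · exact absurd h2.1 (h4 ▸ (hB _ _ h1.2).1 h1.1)

/-! ### Counting the steps of the greedy algorithm -/

/-- In a connected bipartite graph, as long as some but not all neighbours of `B` are covered, a
vertex of `B` has both a covered and an uncovered neighbour. -/
theorem exists_covered_uncovered (hconn : G.Connected) (hB : ∀ u v, G.Adj u v → (u ∈ B ↔ v ∉ B))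
    {L : List (V × V)} (hLB : ∀ q ∈ L, q.1 ∈ B) (hL : L ≠ []) {b : V} (hb : b ∈ B)
    (hne : (G.uncovered L b).Nonempty) :
    ∃ c ∈ B, (G.uncovered L c).Nonempty ∧ ∃ a, G.Adj c a ∧ a ∈ G.covered L := by
  by_contra! hcon
  -- The vertices of `B` without uncovered neighbours, and their neighbours, are closed.
  let S : Set V := {v | (v ∈ B ∧ G.uncovered L v = ∅) ∨ (v ∉ B ∧ v ∈ G.covered L)}
  have hstep : ∀ u v, G.Adj u v → u ∈ S → v ∈ S := by
    rintro u v huv (⟨huB, hu⟩ | ⟨huB, hu⟩)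
    · refine Or.inr ⟨(hB _ _ huv).1 huB, ?_⟩
      by_contra hv
      exact Finset.notMem_empty v (hu ▸ mem_uncovered.2 ⟨huv, hv⟩)
    · have hvB : v ∈ B := (hB _ _ huv.symm).2 huB
      refine Or.inl ⟨hvB, ?_⟩
      by_contra hv
      exact hcon v hvB (Finset.nonempty_iff_ne_empty.2 hv) u huv.symm hu
  obtain ⟨q, L', rfl⟩ := List.exists_cons_of_ne_nil hL
  have hqS : q.1 ∈ S := by
    refine Or.inl ⟨hLB q (by simp), ?_⟩
    rw [Finset.eq_empty_iff_forall_notMem]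
    intro a ha
    exact (mem_uncovered.1 ha).2 (mem_covered.2 ⟨q, by simp, (mem_uncovered.1 ha).1⟩)
  have hwalk : ∀ {u v : V}, G.Walk u v → u ∈ S → v ∈ S := by
    intro u v p
    induction p with
    | nil => exact id
    | cons huv _ ih => exact fun hu => ih (hstep _ _ huv hu)
  obtain ⟨p⟩ := hconn.preconnected q.1 b
  rcases hwalk p hqS with ⟨-, h0⟩ | ⟨h0, -⟩
  · exact hne.ne_empty h0
  · exact h0 hb

open Classical in
/-- The vertices of `B` all of whose neighbours are covered. -/
noncomputable def exhausted (G : SimpleGraph V) (B : Set V) (L : List (V × V)) : Finset V :=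
  {b | b ∈ B ∧ G.uncovered L b = ∅}

/-- The two counts behind the approximation ratio; `p₁` is the number of steps in which the picked
vertex had only one uncovered neighbour. A step covers at most `d` vertices, except that the first
one may cover `d + 1`. In the absence of 4-cycles a vertex that is not picked loses its uncovered
neighbours one at a time, and the last one in a step counted by `p₁`, which exhausts at most `d`
vertices besides the picked one. -/
theorem IsGreedyRun.exists_count (hconn : G.Connected)
    (hB : ∀ u v, G.Adj u v → (u ∈ B ↔ v ∉ B)) (h4 : (cycleGraph 4).Free G) {d e : ℕ} (hd : 1 ≤ d)
    (hdeg : ∀ v, (G.neighborSet v).ncard ≤ d + 1) (hpos : ∀ v, (G.neighborSet v).Nonempty)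
    (he : e = 1 ∨ ∃ b ∈ B, (G.neighborSet b).ncard ≤ d)
    {L : List (V × V)} (h : G.IsGreedyRun B L) :
    ∃ p₁, (G.covered L).card + (d - 1) * p₁ ≤ d * L.length + (if L = [] then 0 else e) ∧
      (G.exhausted B L).card ≤ L.length + d * p₁ := by
  classical
  induction h with
  | nil =>
    refine ⟨0, by simp [covered], ?_⟩
    have : G.exhausted B [] = ∅ := by
      rw [Finset.eq_empty_iff_forall_notMem]
      intro b hb
      obtain ⟨a, ha⟩ := hpos b
      simp only [exhausted, Finset.mem_filter_univ] at hb
      exact Finset.notMem_empty a (hb.2 ▸ mem_uncovered.2 ⟨ha, by simp [covered]⟩)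
    simp [this]
  | @cons L b a hL hb ha hmin ih =>
    obtain ⟨p₁, h1, h2⟩ := ih
    have hunc_le : ∀ (L : List (V × V)) (c : V),
        (G.uncovered L c).card ≤ (G.neighborSet c).ncard := fun L c => by
      rw [← Set.ncard_coe_finset]
      exact Set.ncard_le_ncard (fun x hx => (mem_uncovered.1 hx).1) (Set.toFinite _)
    have hk : (G.uncovered L b).card + (if L = [] then 0 else e) ≤ d + e := by
      split_ifs with hnil
      · rcases he with rfl | ⟨c, hc, hcd⟩
        · exact (hunc_le L b).trans (hdeg b)
        · obtain ⟨x, hx⟩ := hpos c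
          have := hmin c hc ⟨x, mem_uncovered.2 ⟨hx, by simp [hnil, covered]⟩⟩
          have := hunc_le L c
          omega
      · obtain ⟨c, hc, hcne, x, hcx, hx⟩ := exists_covered_uncovered hconn hB
          (fun q hq => (hL.mem hq).1) hnil hb ⟨a, ha⟩
        have h3 := hmin c hc hcne
        have h4 : (G.uncovered L c : Set V) ⊆ G.neighborSet c \ {x} := by
          intro y hy
          refine ⟨(mem_uncovered.1 hy).1, ?_⟩
          rintro rfl
          exact (mem_uncovered.1 hy).2 hx
        have h5 := Set.ncard_le_ncard h4 (Set.toFinite _)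
        have h6 := Set.ncard_sdiff_singleton_add_one (s := G.neighborSet c) (a := x) hcx
          (Set.toFinite _)
        have h7 := hdeg c
        rw [Set.ncard_coe_finset] at h5
        omega
    have hkpos := Finset.card_pos.2 ⟨a, ha⟩
    have hcard := card_covered_cons (G := G) L b a
    -- A vertex other than `b` that the step exhausts has a single uncovered neighbour, in common
    -- with `b`.
    have hnew : ∀ c ∈ G.exhausted B ((b, a) :: L), c ∉ G.exhausted B L → c ≠ b →
        (G.uncovered L b).card = 1 ∧ G.Adj a c := by
      intro c hc hc' hcb
      simp only [exhausted, Finset.mem_filter_univ] at hc hc'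
      have hne : (G.uncovered L c).Nonempty := by
        rw [Finset.nonempty_iff_ne_empty]
        exact fun h0 => hc' ⟨hc.1, h0⟩
      have hadj : ∀ x ∈ G.uncovered L c, G.Adj b x := by
        intro x hx
        by_contra hbx
        have : x ∈ G.uncovered ((b, a) :: L) c := by
          refine mem_uncovered.2 ⟨(mem_uncovered.1 hx).1, ?_⟩
          rw [covered_cons, Finset.mem_union, not_or]
          exact ⟨(mem_uncovered.1 hx).2, fun h' => hbx (mem_uncovered.1 h').1⟩
        rw [hc.2] at this
        simp at this
      have hle : (G.uncovered L c).card ≤ 1 := by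
        rw [Finset.card_le_one]
        intro x hx y hy
        exact eq_of_cycleGraph_four_free h4 hcb (mem_uncovered.1 hx).1 (mem_uncovered.1 hy).1
          (hadj x hx) (hadj y hy)
      have h1 : (G.uncovered L b).card = 1 := by
        have := hmin c hc.1 hne
        omega
      refine ⟨h1, ?_⟩
      obtain ⟨x, hx⟩ := hne
      have hxa : x = a := Finset.card_le_one.1 h1.le x
        (mem_uncovered.2 ⟨hadj x hx, (mem_uncovered.1 hx).2⟩) a ha
      rw [← hxa]
      exact (mem_uncovered.1 hx).1.symm
    have hlen : d * ((b, a) :: L).length = d * L.length + d := by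
      rw [List.length_cons]; ring
    by_cases hone : (G.uncovered L b).card = 1
    · refine ⟨p₁ + 1, ?_, ?_⟩
      · rw [if_neg (List.cons_ne_nil _ _), hlen, hcard, mul_add]
        have : (if L = [] then 0 else e) ≤ e := by split_ifs <;> omega
        omega
      · have hsub : G.exhausted B ((b, a) :: L) ⊆
            G.exhausted B L ∪ (G.neighborSet a).toFinset := by
          intro c hc
          rw [Finset.mem_union, Set.mem_toFinset]
          by_contra! hcon
          by_cases hcb : c = b
          · exact hcon.2 (hcb ▸ (mem_uncovered.1 ha).1.symm)
          · exact hcon.2 (hnew c hc hcon.1 hcb).2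
        have h5 := (Finset.card_le_card hsub).trans (Finset.card_union_le _ _)
        have h6 := hdeg a
        rw [Set.ncard_eq_toFinset_card'] at h6
        rw [List.length_cons, mul_add]
        omega
    · refine ⟨p₁, ?_, ?_⟩
      · rw [if_neg (List.cons_ne_nil _ _), hlen, hcard]
        omega
      · have hsub : G.exhausted B ((b, a) :: L) ⊆ insert b (G.exhausted B L) := by
          intro c hc
          rw [Finset.mem_insert]
          by_contra! hcon
          exact hone (hnew c hc hcon.2 hcon.1).1
        have h5 := (Finset.card_le_card hsub).trans (Finset.card_insert_le _ _)
        rw [List.length_cons]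
        omega

/-- A greedy run that covers all neighbours of `B` has at least `(2d - 1) / (d² + d - 1)` times as
many steps as a uniquely restricted matching has edges. -/
theorem IsGreedyRun.mul_urMatchingNumber_le (hconn : G.Connected)
    (hB : ∀ u v, G.Adj u v → (u ∈ B ↔ v ∉ B)) (h4 : (cycleGraph 4).Free G) {d : ℕ} (hd : 1 ≤ d)
    (hdeg : ∀ v, (G.neighborSet v).ncard ≤ d + 1)
    {L : List (V × V)} (h : G.IsGreedyRun B L) (hdone : ∀ b ∈ B, G.uncovered L b = ∅) :
    (2 * d - 1) * G.urMatchingNumber ≤ (d ^ 2 + d - 1) * L.length := by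
  classical
  have hC : ∀ b ∈ B, ∀ a, G.Adj b a → a ∈ (G.covered L : Set V) := by
    intro b hb a hba
    by_contra ha
    exact Finset.notMem_empty a (hdone b hb ▸ mem_uncovered.2 ⟨hba, ha⟩)
  have hνC := urMatchingNumber_le_ncard_of_adj hB hC
  have hνB := urMatchingNumber_le_ncard hB
  rw [Set.ncard_coe_finset] at hνC
  rcases Nat.eq_zero_or_pos G.urMatchingNumber with h0 | hνpos
  · simp [h0]
  have hLne : L ≠ [] := by
    rintro rfl
    simp [covered] at hνC
    omega
  have hBne : B.Nonempty := by
    rw [Set.nonempty_iff_ne_empty]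
    rintro rfl
    simp at hνB
    omega
  have hpos : ∀ v, (G.neighborSet v).Nonempty := by
    obtain ⟨q, hq⟩ := List.exists_mem_of_ne_nil L hLne
    have : Nontrivial V := ⟨_, _, (h.mem hq).2.ne⟩
    intro v
    obtain ⟨w, hw⟩ := hconn.preconnected.exists_adj_of_nontrivial v
    exact ⟨w, hw⟩
  have hexh : (G.exhausted B L).card = B.ncard := by
    rw [← Set.ncard_coe_finset]
    congr 1
    ext b
    simp only [exhausted, Finset.coe_filter_univ, Set.mem_ofPred_eq]
    exact ⟨And.left, fun hb => ⟨hb, hdone b hb⟩⟩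
  have hmain : ∃ p₁, G.urMatchingNumber + (d - 1) * p₁ ≤ d * L.length ∧
      G.urMatchingNumber ≤ L.length + d * p₁ := by
    by_cases hlow : ∃ b ∈ B, (G.neighborSet b).ncard ≤ d
    · obtain ⟨p₁, h1, h2⟩ := h.exists_count hconn hB h4 hd hdeg hpos (e := 0) (Or.inr hlow)
      refine ⟨p₁, ?_, ?_⟩
      · simp only [ite_self] at h1
        omega
      · omega
    · push Not at hlow
      obtain ⟨p₁, h1, h2⟩ := h.exists_count hconn hB h4 hd hdeg hpos (e := 1) (Or.inl rfl)
      have h3 := urMatchingNumber_add_le_ncard hB hC hlow hBne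
      rw [Set.ncard_coe_finset] at h3
      refine ⟨p₁, ?_, ?_⟩
      · rw [if_neg hLne] at h1
        omega
      · omega
  obtain ⟨p₁, h1, h2⟩ := hmain
  obtain ⟨c, rfl⟩ := Nat.exists_eq_add_of_le' hd
  have e1 : 2 * (c + 1) - 1 = 2 * c + 1 := by omega
  have e2 : (c + 1) ^ 2 + (c + 1) - 1 = (c + 1) ^ 2 + c := by omega
  rw [e1, e2]
  rw [Nat.add_sub_cancel] at h1
  -- The weights `d` and `d - 1` eliminate `p₁`.
  have h3 := Nat.mul_le_mul_left (c + 1) h1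
  have h4 := Nat.mul_le_mul_left c h2
  nlinarith

/-- The ratio of the greedy algorithm is at least the ratio to be shown, as the difference has the
sign of `d (d - 1) ^ 3` for `d = Δ - 1`. -/
theorem IsGreedyRun.ratio_mul_urMatchingNumber_le (hconn : G.Connected)
    (hB : ∀ u v, G.Adj u v → (u ∈ B ↔ v ∉ B)) (h4 : (cycleGraph 4).Free G) {Δ : ℕ} (hΔ : 3 ≤ Δ)
    (hdeg : ∀ v, (G.neighborSet v).ncard ≤ Δ)
    {L : List (V × V)} (h : G.IsGreedyRun B L) (hdone : ∀ b ∈ B, G.uncovered L b = ∅) :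
    ((((Δ : ℚ) - 1) ^ 2 + ((Δ : ℚ) - 2)) / (((Δ : ℚ) - 1) ^ 3 + ((Δ : ℚ) - 2))) *
      (G.urMatchingNumber : ℚ) ≤ (L.length : ℚ) := by
  obtain ⟨c, rfl⟩ := Nat.exists_eq_add_of_le' hΔ
  have h1 := h.mul_urMatchingNumber_le hconn hB h4 (d := c + 2) (by omega) hdeg hdone
  have e1 : 2 * (c + 2) - 1 = 2 * c + 3 := by omega
  have e2 : (c + 2) ^ 2 + (c + 2) - 1 = (c + 2) ^ 2 + (c + 1) := by omega
  rw [e1, e2] at h1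
  have h2 : (2 * (c : ℚ) + 3) * G.urMatchingNumber ≤ ((c + 2) ^ 2 + (c + 1)) * L.length := by
    exact_mod_cast h1
  have hc : (0 : ℚ) ≤ c := c.cast_nonneg
  have hν : (0 : ℚ) ≤ G.urMatchingNumber := Nat.cast_nonneg _
  push_cast
  have e3 : (c : ℚ) + 3 - 1 = c + 2 := by ring
  have e4 : (c : ℚ) + 3 - 2 = c + 1 := by ring
  rw [e3, e4, div_mul_eq_mul_div, div_le_iff₀ (by positivity)]
  have hD : (0 : ℚ) < (c + 2) ^ 2 + (c + 1) := by positivity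
  refine le_of_mul_le_mul_left ?_ hD
  calc (((c : ℚ) + 2) ^ 2 + (c + 1)) * ((((c : ℚ) + 2) ^ 2 + (c + 1)) * G.urMatchingNumber)
      ≤ (((c : ℚ) + 2) ^ 3 + (c + 1)) * ((2 * (c : ℚ) + 3) * G.urMatchingNumber) := by
        have : (0 : ℚ) ≤ (c + 2) * (c + 1) ^ 3 * G.urMatchingNumber := by positivity
        linarith
    _ ≤ (((c : ℚ) + 2) ^ 3 + (c + 1)) * (((c + 2) ^ 2 + (c + 1)) * L.length) :=
        mul_le_mul_of_nonneg_left h2 (by positivity)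
    _ = _ := by ring

end SimpleGraph

/-! ### Total correctness with time bounds -/

namespace RAM

/-- Started in the state `s`, the program `P` terminates after at most `T` operations in a state that
satisfies `Q`. -/
def Runs (P : Prog) (s : State) (T : ℕ) (Q : State → Prop) : Prop :=
  ∃ t s', Exec P s t s' ∧ t ≤ T ∧ Q s'

theorem Runs.mono {P : Prog} {s : State} {T T' : ℕ} {Q Q' : State → Prop} (h : Runs P s T Q)
    (hT : T ≤ T') (hQ : ∀ s', Q s' → Q' s') : Runs P s T' Q' := by
  obtain ⟨t, s', h1, h2, h3⟩ := h
  exact ⟨t, s', h1, h2.trans hT, hQ _ h3⟩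

theorem Runs.skip {s : State} {T : ℕ} {Q : State → Prop} (hT : 1 ≤ T) (h : Q s) :
    Runs Prog.skip s T Q :=
  ⟨1, s, Exec.skip s, hT, h⟩

theorem Runs.assign {x : ℕ} {e : Expr} {s : State} {T : ℕ} {Q : State → Prop}
    (hT : e.cost + 1 ≤ T) (h : Q (s.setVar x (e.eval s))) : Runs (Prog.assign x e) s T Q :=
  ⟨_, _, Exec.assign s x e, hT, h⟩

theorem Runs.put {a : ℕ} {i j e : Expr} {s : State} {T : ℕ} {Q : State → Prop}
    (hT : i.cost + j.cost + e.cost + 1 ≤ T)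
    (h : Q (s.setArr a (i.eval s) (j.eval s) (e.eval s))) : Runs (Prog.put a i j e) s T Q :=
  ⟨_, _, Exec.put s a i j e, hT, h⟩

theorem Runs.seq {p q : Prog} {s : State} {T₁ T₂ T : ℕ} {Q : State → Prop}
    (h : Runs p s T₁ fun s' => Runs q s' T₂ Q) (hT : T₁ + T₂ ≤ T) : Runs (Prog.seq p q) s T Q := by
  obtain ⟨t₁, s₁, h1, h2, t₂, s₂, h3, h4, h5⟩ := h
  exact ⟨_, _, Exec.seq h1 h3, (Nat.add_le_add h2 h4).trans hT, h5⟩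

theorem Runs.cond {e : Expr} {p q : Prog} {s : State} {T' T : ℕ} {Q : State → Prop}
    (hT : e.cost + 1 + T' ≤ T) (h1 : e.eval s ≠ 0 → Runs p s T' Q)
    (h2 : e.eval s = 0 → Runs q s T' Q) : Runs (Prog.cond e p q) s T Q := by
  by_cases he : e.eval s = 0
  · obtain ⟨t, s', h, ht, hQ⟩ := h2 he
    exact ⟨_, _, Exec.condFalse he h, by omega, hQ⟩
  · obtain ⟨t, s', h, ht, hQ⟩ := h1 he
    exact ⟨_, _, Exec.condTrue he h, by omega, hQ⟩

/-- `for x := 0, …, n - 1 do p`, where the number `n` is the value of the variable `0`. -/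
def forLoop (x : ℕ) (p : Prog) : Prog :=
  .seq (.assign x (.const 0))
    (.loop (.lt (.var x) (.var 0)) (.seq p (.assign x (.add (.var x) (.const 1)))))

/-- The invariant rule for `forLoop`. -/
theorem Runs.forLoop {n x : ℕ} {p : Prog} {s : State} {T : ℕ} (I : ℕ → State → Prop) (hx : x ≠ 0)
    (hn : s.var 0 = n) (h0 : I 0 (s.setVar x 0))
    (hstep : ∀ (k : Fin n) (s' : State), s'.var 0 = n → s'.var x = k → I k s' →
      Runs p s' T fun s'' =>
        s''.var 0 = n ∧ s''.var x = k ∧ I (k + 1) (s''.setVar x (k + 1)))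
    {T' : ℕ} {Q : State → Prop} (hT : n * (T + 8) + 6 ≤ T')
    (hQ : ∀ s', s'.var 0 = n → I n s' → Q s') : Runs (forLoop x p) s T' Q := by
  have hloop : ∀ m k (s' : State), k + m = n → s'.var 0 = n → s'.var x = k → I k s' →
      Runs (.loop (.lt (.var x) (.var 0)) (.seq p (.assign x (.add (.var x) (.const 1))))) s'
        (m * (T + 8) + 4) Q := by
    intro m
    induction m with
    | zero =>
      intro k s' hk h0 hxk hI
      obtain rfl : k = n := by omega
      exact ⟨_, s', Exec.loopFalse (by simp [Expr.eval, h0, hxk]), by simp [Expr.cost], hQ s' h0 hI⟩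
    | succ m ih =>
      intro k s' hk h0 hxk hI
      obtain ⟨t, s₁, h1, h2, h3, h4, h5⟩ := hstep ⟨k, by omega⟩ s' h0 hxk hI
      have h4 : s₁.var x = k := h4
      obtain ⟨t', s₂, h6, h7, h8⟩ := ih (k + 1) (s₁.setVar x (k + 1)) (by omega)
        (by simp [State.setVar, hx.symm, h3]) (by simp [State.setVar]) h5
      have h9 : Exec (.assign x (.add (.var x) (.const 1))) s₁ 4 (s₁.setVar x (k + 1)) := by
        have := Exec.assign s₁ x (.add (.var x) (.const 1))
        simpa [Expr.eval, Expr.cost, h4] using this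
      have hlt : (Expr.lt (.var x) (.var 0)).eval s' ≠ 0 := by
        simp only [Expr.eval, h0, hxk]
        rw [if_pos (by omega)]
        exact one_ne_zero
      refine ⟨_, s₂, Exec.loopTrue hlt (Exec.seq h1 h9) h6, ?_, h8⟩
      simp only [Expr.cost]
      rw [Nat.succ_mul]
      omega
  refine Runs.seq (T₁ := 2) (T₂ := n * (T + 8) + 4) (Runs.assign (by simp [Expr.cost]) ?_) (by omega)
  refine hloop n 0 _ (by omega) ?_ ?_ ?_
  · simp [State.setVar, hx.symm, hn]
  · simp [State.setVar, Expr.eval]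
  · exact h0

/-! ### The program -/

/-- Marks in array `2` the vertices at an even distance from the vertex `0`. Each of the `n` rounds
marks everything at distance two from a marked vertex. -/
def markProg : Prog :=
  .seq (.put 2 (.const 0) (.const 0) (.const 1))
    (forLoop 1 (forLoop 2 (.cond (.get 2 (.var 2) (.const 0))
      (forLoop 3 (.cond (.get 0 (.var 2) (.var 3))
        (forLoop 4 (.cond (.get 0 (.var 3) (.var 4))
          (.put 2 (.var 4) (.const 0) (.const 1)) .skip)) .skip)) .skip)))

/-- Counts in variable `5` the uncovered neighbours of the vertex in variable `2`, and stores one of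
them in variable `6`. Array `3` holds the covered vertices. -/
def countProg : Prog :=
  .seq (.assign 5 (.const 0))
    (forLoop 3 (.cond (.get 0 (.var 2) (.var 3))
      (.cond (.get 3 (.var 3) (.const 0)) .skip
        (.seq (.assign 5 (.add (.var 5) (.const 1))) (.assign 6 (.var 3)))) .skip))

/-- Replaces the best candidate so far by the vertex in variable `2` if that one is better. Variables
`7`, `8`, `9` hold the number of uncovered neighbours of the best candidate (`0` if there is none),
the candidate, and one of its uncovered neighbours. -/
def compareProg : Prog :=
  .cond (.var 5)
    (.cond (.add (.eq (.var 7) (.const 0)) (.lt (.var 5) (.var 7)))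
      (.seq (.assign 7 (.var 5)) (.seq (.assign 8 (.var 2)) (.assign 9 (.var 6)))) .skip) .skip

/-- Finds a marked vertex with the smallest positive number of uncovered neighbours. -/
def scanProg : Prog :=
  .seq (.assign 7 (.const 0))
    (forLoop 2 (.cond (.get 2 (.var 2) (.const 0)) (.seq countProg compareProg) .skip))

/-- Adds the edge to the best candidate's neighbour to the matching in array `1`, and covers all
neighbours of the candidate. -/
def pickProg : Prog :=
  .seq (.put 1 (.var 8) (.var 9) (.const 1))
    (.seq (.put 1 (.var 9) (.var 8) (.const 1))
      (forLoop 3 (.cond (.get 0 (.var 8) (.var 3)) (.put 3 (.var 3) (.const 0) (.const 1)) .skip)))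

/-- The greedy algorithm. -/
def greedyProg : Prog :=
  .seq markProg (forLoop 1 (.seq scanProg (.cond (.var 7) pickProg .skip)))

end RAM

/-! ### Correctness of the marking phase -/

namespace RAM

open SimpleGraph

variable {n : ℕ} {G : SimpleGraph (Fin n)} {B : Set (Fin n)}

/-- Array `0` holds the adjacency matrix of `G`; nonzero entries count as `1`. -/
def HasGraph (G : SimpleGraph (Fin n)) (s : State) : Prop :=
  ∀ i j : Fin n, s.arr 0 i j ≠ 0 ↔ G.Adj i j

/-- The vertices that are flagged in column `0` of the array `a`. -/
def flagged (n a : ℕ) (s : State) : Set (Fin n) :=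
  {i | s.arr a i 0 ≠ 0}

theorem mem_flagged {a : ℕ} {s : State} {i : Fin n} : i ∈ flagged n a s ↔ s.arr a i 0 ≠ 0 :=
  Iff.rfl

theorem flagged_setVar (a : ℕ) (s : State) (x v : ℕ) :
    flagged n a (s.setVar x v) = flagged n a s := rfl

theorem flagged_setArr (a : ℕ) (s : State) (i : Fin n) :
    flagged n a (s.setArr a i 0 1) = insert i (flagged n a s) := by
  ext k
  by_cases h : k = i
  · simp [mem_flagged, State.setArr, h]
  · simp [mem_flagged, State.setArr, h, Fin.val_inj]

/-- The state `s'` comes from `s` by marking more vertices of `B` in array `2`, without a change to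
other arrays or to the variables below `c`. -/
structure Marks (B : Set (Fin n)) (c : ℕ) (s s' : State) : Prop where
  var_eq : ∀ y < c, s'.var y = s.var y
  arr_eq : ∀ a ≠ 2, s'.arr a = s.arr a
  subset : flagged n 2 s ⊆ flagged n 2 s'
  subset_part : flagged n 2 s' ⊆ B

theorem Marks.refl {c : ℕ} {s : State} (h : flagged n 2 s ⊆ B) : Marks B c s s :=
  ⟨fun _ _ => rfl, fun _ _ => rfl, subset_rfl, h⟩

theorem Marks.setVar {c x v : ℕ} {s s' : State} (h : Marks B c s s') (hx : c ≤ x) :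
    Marks B c s (s'.setVar x v) := by
  refine ⟨fun y hy => ?_, h.arr_eq, h.subset, h.subset_part⟩
  rw [← h.var_eq y hy]
  exact if_neg (by omega)

theorem Marks.trans {c c' : ℕ} {s s₁ s₂ : State} (h : Marks B c s s₁) (h' : Marks B c' s₁ s₂)
    (hc : c ≤ c') : Marks B c s s₂ :=
  ⟨fun y hy => (h'.var_eq y (by omega)).trans (h.var_eq y hy),
    fun a ha => (h'.arr_eq a ha).trans (h.arr_eq a ha), h.subset.trans h'.subset, h'.subset_part⟩

theorem Marks.hasGraph {c : ℕ} {s s' : State} (h : Marks B c s s') (hG : HasGraph G s) :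
    HasGraph G s' := by
  intro i j
  rw [h.arr_eq 0 (by decide)]
  exact hG i j

theorem runs_mark_neighbors (hcl : ∀ i ∈ B, ∀ j l, G.Adj i j → G.Adj j l → l ∈ B) {s : State}
    {i j : Fin n} (hG : HasGraph G s) (hn : s.var 0 = n) (hj : s.var 3 = j) (hi : i ∈ B)
    (hij : G.Adj i j) (hs : flagged n 2 s ⊆ B) :
    Runs (forLoop 4 (.cond (.get 0 (.var 3) (.var 4)) (.put 2 (.var 4) (.const 0) (.const 1)) .skip))
      s (n * 16 + 6) fun s' => Marks B 4 s s' ∧ ∀ l, G.Adj j l → l ∈ flagged n 2 s' := by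
  refine Runs.forLoop
    (fun k s' => Marks B 4 s s' ∧ ∀ l : Fin n, l < k → G.Adj j l → l ∈ flagged n 2 s')
    (by decide) hn ⟨(Marks.refl hs).setVar le_rfl, by simp⟩ ?_ (T := 8) le_rfl
    (fun s' _ h => ⟨h.1, fun l => h.2 l l.2⟩)
  rintro k s' h0 hk ⟨hM, hI⟩
  have h3 : s'.var 3 = j := (hM.var_eq 3 (by decide)).trans hj
  have hval : (Expr.get 0 (.var 3) (.var 4)).eval s' = s'.arr 0 j k := by simp [Expr.eval, h3, hk]
  refine Runs.cond (T' := 4) (by simp [Expr.cost]) (fun he => ?_) (fun he => ?_)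
  · rw [hval, hM.hasGraph hG] at he
    refine Runs.put (by simp [Expr.cost]) ?_
    simp only [Expr.eval, hk]
    have hM' : Marks B 4 s (s'.setArr 2 k 0 1) := by
      refine ⟨hM.var_eq, fun a ha => ?_, ?_, ?_⟩
      · rw [← hM.arr_eq a ha]
        funext x y
        exact if_neg (by tauto)
      · rw [flagged_setArr]
        exact hM.subset.trans (Set.subset_insert _ _)
      · rw [flagged_setArr]
        exact Set.insert_subset (hcl i hi j k hij he) hM.subset_part
    refine ⟨h0, hk, hM'.setVar le_rfl, fun l hl hjl => ?_⟩
    rw [flagged_setVar, flagged_setArr]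
    rcases Nat.lt_succ_iff_lt_or_eq.1 hl with hl | hl
    · exact Or.inr (hI l hl hjl)
    · exact Or.inl (Fin.ext hl)
  · rw [hval] at he
    refine Runs.skip (by decide) ⟨h0, hk, hM.setVar le_rfl, fun l hl hjl => ?_⟩
    rcases Nat.lt_succ_iff_lt_or_eq.1 hl with hl | hl
    · exact hI l hl hjl
    · exact absurd he ((hM.hasGraph hG j k).2 (Fin.ext hl ▸ hjl))

theorem runs_mark_two_steps (hcl : ∀ i ∈ B, ∀ j l, G.Adj i j → G.Adj j l → l ∈ B) {s : State}
    {i : Fin n} (hG : HasGraph G s) (hn : s.var 0 = n) (hvi : s.var 2 = i) (hi : i ∈ B)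
    (hs : flagged n 2 s ⊆ B) :
    Runs (forLoop 3 (.cond (.get 0 (.var 2) (.var 3)) (forLoop 4 (.cond (.get 0 (.var 3) (.var 4))
        (.put 2 (.var 4) (.const 0) (.const 1)) .skip)) .skip))
      s (n * (n * 16 + 18) + 6) fun s' =>
        Marks B 3 s s' ∧ ∀ j l, G.Adj i j → G.Adj j l → l ∈ flagged n 2 s' := by
  refine Runs.forLoop (fun k s' => Marks B 3 s s' ∧
      ∀ j : Fin n, j < k → ∀ l, G.Adj i j → G.Adj j l → l ∈ flagged n 2 s')
    (by decide) hn ⟨(Marks.refl hs).setVar le_rfl, by simp⟩ ?_ (T := n * 16 + 10) le_rfl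
    (fun s' _ h => ⟨h.1, fun j => h.2 j j.2⟩)
  rintro k s' h0 hk ⟨hM, hI⟩
  have h2 : s'.var 2 = i := (hM.var_eq 2 (by decide)).trans hvi
  have hval : (Expr.get 0 (.var 2) (.var 3)).eval s' = s'.arr 0 i k := by simp [Expr.eval, h2, hk]
  refine Runs.cond (T' := n * 16 + 6) (by simp [Expr.cost]; omega) (fun he => ?_) (fun he => ?_)
  · rw [hval, hM.hasGraph hG] at he
    refine (runs_mark_neighbors hcl (hM.hasGraph hG) h0 hk hi he hM.subset_part).mono le_rfl ?_
    rintro s₂ ⟨hM₂, hl₂⟩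
    refine ⟨(hM₂.var_eq 0 (by decide)).trans h0, (hM₂.var_eq 3 (by decide)).trans hk,
      (hM.trans hM₂ (by decide)).setVar le_rfl, fun j hj l hij hjl => ?_⟩
    rcases Nat.lt_succ_iff_lt_or_eq.1 hj with hj | hj
    · exact hM₂.subset (hI j hj l hij hjl)
    · obtain rfl : j = k := Fin.ext hj
      exact hl₂ l hjl
  · rw [hval] at he
    refine Runs.skip (by omega) ⟨h0, hk, hM.setVar le_rfl, fun j hj l hij hjl => ?_⟩
    rcases Nat.lt_succ_iff_lt_or_eq.1 hj with hj | hj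
    · exact hI j hj l hij hjl
    · exact absurd he ((hM.hasGraph hG i k).2 (Fin.ext hj ▸ hij))

theorem runs_mark_round (hcl : ∀ i ∈ B, ∀ j l, G.Adj i j → G.Adj j l → l ∈ B) {s : State}
    (hG : HasGraph G s) (hn : s.var 0 = n) (hs : flagged n 2 s ⊆ B) :
    Runs (forLoop 2 (.cond (.get 2 (.var 2) (.const 0)) (forLoop 3 (.cond (.get 0 (.var 2) (.var 3))
        (forLoop 4 (.cond (.get 0 (.var 3) (.var 4))
          (.put 2 (.var 4) (.const 0) (.const 1)) .skip)) .skip)) .skip))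
      s (n * (n * (n * 16 + 18) + 18) + 6) fun s' => Marks B 2 s s' ∧
        ∀ i ∈ flagged n 2 s, ∀ j l, G.Adj i j → G.Adj j l → l ∈ flagged n 2 s' := by
  refine Runs.forLoop (fun k s' => Marks B 2 s s' ∧
      ∀ i : Fin n, i < k → i ∈ flagged n 2 s → ∀ j l, G.Adj i j → G.Adj j l → l ∈ flagged n 2 s')
    (by decide) hn ⟨(Marks.refl hs).setVar le_rfl, by simp⟩ ?_ (T := n * (n * 16 + 18) + 10) le_rfl
    (fun s' _ h => ⟨h.1, fun i => h.2 i i.2⟩)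
  rintro k s' h0 hk ⟨hM, hI⟩
  have hval : (Expr.get 2 (.var 2) (.const 0)).eval s' = s'.arr 2 k 0 := by simp [Expr.eval, hk]
  refine Runs.cond (T' := n * (n * 16 + 18) + 6) (by simp [Expr.cost]; omega)
    (fun he => ?_) (fun he => ?_)
  · rw [hval] at he
    refine (runs_mark_two_steps hcl (hM.hasGraph hG) h0 hk (hM.subset_part he)
      hM.subset_part).mono le_rfl ?_
    rintro s₂ ⟨hM₂, hl₂⟩
    refine ⟨(hM₂.var_eq 0 (by decide)).trans h0, (hM₂.var_eq 2 (by decide)).trans hk,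
      (hM.trans hM₂ (by decide)).setVar le_rfl, fun i hi his j l hij hjl => ?_⟩
    rcases Nat.lt_succ_iff_lt_or_eq.1 hi with hi | hi
    · exact hM₂.subset (hI i hi his j l hij hjl)
    · obtain rfl : i = k := Fin.ext hi
      exact hl₂ j l hij hjl
  · rw [hval] at he
    refine Runs.skip (by omega) ⟨h0, hk, hM.setVar le_rfl, fun i hi his j l hij hjl => ?_⟩
    rcases Nat.lt_succ_iff_lt_or_eq.1 hi with hi | hi
    · exact hI i hi his j l hij hjl
    · exact absurd he (hM.subset (Fin.ext hi ▸ his))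

/-- If `B` is the set of vertices at an even distance from the vertex `0`, then `markProg` marks
exactly the vertices of `B`. -/
theorem runs_markProg (hcl : ∀ i ∈ B, ∀ j l, G.Adj i j → G.Adj j l → l ∈ B) (hpos : 0 < n)
    (h0B : ⟨0, hpos⟩ ∈ B)
    (hB : ∀ b ∈ B, ∃ (r : ℕ) (p : G.Walk ⟨0, hpos⟩ b), p.length = 2 * r ∧ r ≤ n)
    {s : State} (hG : HasGraph G s) (hn : s.var 0 = n) (hs : flagged n 2 s = ∅) :
    Runs markProg s (n * (n * (n * (n * 16 + 18) + 18) + 14) + 10) fun s' =>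
      s'.var 0 = n ∧ (∀ a ≠ 2, s'.arr a = s.arr a) ∧ flagged n 2 s' = B := by
  unfold markProg
  refine Runs.seq (T₁ := 4) (T₂ := n * (n * (n * (n * 16 + 18) + 18) + 14) + 6)
    (Runs.put (by simp [Expr.cost]) ?_) (by omega)
  simp only [Expr.eval]
  set s₀ := s.setArr 2 0 0 1 with hs₀
  have hflag : flagged n 2 s₀ = {⟨0, hpos⟩} := by
    have := flagged_setArr 2 s (⟨0, hpos⟩ : Fin n)
    rw [hs] at this
    simpa using this
  have harr : ∀ a ≠ 2, s₀.arr a = s.arr a := by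
    intro a ha
    funext x y
    exact if_neg (by tauto)
  have hG₀ : HasGraph G s₀ := by
    intro i j
    rw [harr 0 (by decide)]
    exact hG i j
  refine Runs.forLoop (fun k s' => Marks B 1 s₀ s' ∧
      ∀ r ≤ k, ∀ (v : Fin n) (p : G.Walk ⟨0, hpos⟩ v), p.length = 2 * r → v ∈ flagged n 2 s')
    (by decide) (show s₀.var 0 = n from hn) ⟨(Marks.refl ?_).setVar le_rfl, ?_⟩ ?_
    (T := n * (n * (n * 16 + 18) + 18) + 6) le_rfl (fun s' h0 h => ⟨h0, ?_, ?_⟩)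
  · rw [hflag]
    simpa using h0B
  · intro r hr v p hp
    obtain rfl : r = 0 := by omega
    rw [flagged_setVar, hflag, ← Walk.eq_of_length_eq_zero hp]
    rfl
  · rintro k s' h0 hk ⟨hM, hI⟩
    refine (runs_mark_round hcl (hM.hasGraph hG₀) h0 hM.subset_part).mono le_rfl ?_
    rintro s₂ ⟨hM₂, hl₂⟩
    refine ⟨(hM₂.var_eq 0 (by decide)).trans h0, (hM₂.var_eq 1 (by decide)).trans hk,
      (hM.trans hM₂ (by decide)).setVar le_rfl, fun r hr v p hp => ?_⟩
    rcases Nat.le_succ_iff.1 hr with hr | rfl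
    · exact hM₂.subset (hI r hr v p hp)
    · -- Split off the last two edges of the walk.
      have h1 := p.adj_getVert_succ (i := 2 * k) (by omega)
      have h2 := p.adj_getVert_succ (i := 2 * k + 1) (by omega)
      rw [show 2 * (k : ℕ) + 1 + 1 = p.length by omega, p.getVert_length] at h2
      refine hl₂ _ (hI k le_rfl _ (p.take (2 * k)) ?_) _ _ h1 h2
      rw [Walk.take_length]
      omega
  · intro a ha
    rw [h.1.arr_eq a ha, harr a ha]
  · refine h.1.subset_part.antisymm fun b hb => ?_
    obtain ⟨r, p, hp, hr⟩ := hB b hb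
    exact h.2 r hr b p hp

end RAM

/-! ### Correctness of the greedy phase -/

namespace RAM

open SimpleGraph

variable {n : ℕ} {G : SimpleGraph (Fin n)} {B : Set (Fin n)} {L : List (Fin n × Fin n)}

theorem runs_countProg {s : State} {i : Fin n} (hG : HasGraph G s) (hn : s.var 0 = n)
    (hi : s.var 2 = i) (hcov : flagged n 3 s = G.covered L) :
    Runs countProg s (n * 24 + 8) fun s' => s'.arr = s.arr ∧
      (∀ y, y ≠ 3 → y ≠ 5 → y ≠ 6 → s'.var y = s.var y) ∧
      s'.var 5 = (G.uncovered L i).card ∧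
      (s'.var 5 ≠ 0 → ∃ a ∈ G.uncovered L i, s'.var 6 = a) := by
  unfold countProg
  refine Runs.seq (T₁ := 2) (T₂ := n * 24 + 6) (Runs.assign (by simp [Expr.cost]) ?_) (by omega)
  refine Runs.forLoop (s := s.setVar 5 0) (fun k s' => s'.arr = s.arr ∧
      (∀ y, y ≠ 3 → y ≠ 5 → y ≠ 6 → s'.var y = s.var y) ∧
      s'.var 5 = ((G.uncovered L i).filter (fun a : Fin n => (a : ℕ) < k)).card ∧
      (s'.var 5 ≠ 0 → ∃ a ∈ G.uncovered L i, s'.var 6 = a))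
    (by decide) (by exact hn) ⟨rfl, ?_, ?_, ?_⟩ ?_ (T := 16) le_rfl
    (fun s' _ h => ⟨h.1, h.2.1, ?_, h.2.2.2⟩)
  · intro y h3 h5 _
    simp [State.setVar, h3, h5]
  · simp [State.setVar]
  · simp [State.setVar]
  · rintro k s' h0 hk ⟨harr, hvar, hcnt, hlast⟩
    have h2 : s'.var 2 = i := (hvar 2 (by decide) (by decide) (by decide)).trans hi
    have hadj : (Expr.get 0 (.var 2) (.var 3)).eval s' ≠ 0 ↔ G.Adj i k := by
      simp only [Expr.eval, h2, hk, harr]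
      exact hG i k
    have hcv : (Expr.get 3 (.var 3) (.const 0)).eval s' ≠ 0 ↔ k ∈ G.covered L := by
      simp only [Expr.eval, hk, harr]
      rw [← mem_flagged, hcov, Finset.mem_coe]
    have hfilter_eq : k ∉ G.uncovered L i →
        (G.uncovered L i).filter (fun a : Fin n => (a : ℕ) < k + 1) =
          (G.uncovered L i).filter (fun a : Fin n => (a : ℕ) < k) := by
      intro hmem
      refine Finset.filter_congr fun a ha => ?_
      have : a ≠ k := fun h => hmem (h ▸ ha)
      have : (a : ℕ) ≠ k := fun h => this (Fin.ext h)
      omega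
    have hskip : k ∉ G.uncovered L i → s'.var 0 = n ∧ s'.var 3 = k ∧
        (s'.setVar 3 (k + 1)).arr = s.arr ∧
        (∀ y, y ≠ 3 → y ≠ 5 → y ≠ 6 → (s'.setVar 3 (k + 1)).var y = s.var y) ∧
        (s'.setVar 3 (k + 1)).var 5 =
          ((G.uncovered L i).filter (fun a : Fin n => (a : ℕ) < k + 1)).card ∧
        ((s'.setVar 3 (k + 1)).var 5 ≠ 0 →
          ∃ a ∈ G.uncovered L i, (s'.setVar 3 (k + 1)).var 6 = a) := by
      intro hmem
      refine ⟨h0, hk, harr, fun y h3 h5 h6 => ?_, ?_, ?_⟩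
      · simpa [State.setVar, h3] using hvar y h3 h5 h6
      · rw [hfilter_eq hmem]
        simpa [State.setVar] using hcnt
      · simpa [State.setVar] using hlast
    refine Runs.cond (T' := 12) (by simp [Expr.cost]) (fun he => ?_) (fun he => ?_)
    · rw [hadj] at he
      refine Runs.cond (T' := 8) (by simp [Expr.cost]) (fun hc => ?_) (fun hc => ?_)
      · rw [hcv] at hc
        exact Runs.skip (by decide) (hskip fun h => (mem_uncovered.1 h).2 hc)
      · have hc : k ∉ G.covered L := fun h => hcv.2 h hc
        have hmem : k ∈ G.uncovered L i := mem_uncovered.2 ⟨he, hc⟩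
        refine Runs.seq (T₁ := 4) (T₂ := 4) (Runs.assign (by simp [Expr.cost]) ?_) (by decide)
        refine Runs.assign (by simp [Expr.cost]) ⟨?_, ?_, harr, fun y h3 h5 h6 => ?_, ?_, ?_⟩
        · simpa [State.setVar, Expr.eval] using h0
        · simpa [State.setVar, Expr.eval] using hk
        · simpa [State.setVar, Expr.eval, h3, h5, h6] using hvar y h3 h5 h6
        · have : (G.uncovered L i).filter (fun a : Fin n => (a : ℕ) < k + 1) =
              insert k ((G.uncovered L i).filter (fun a : Fin n => (a : ℕ) < k)) := by
            ext a
            simp only [Finset.mem_filter, Finset.mem_insert, Nat.lt_succ_iff_lt_or_eq,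
              Fin.val_inj]
            constructor
            · rintro ⟨h1, h2 | h2⟩
              exacts [Or.inr ⟨h1, h2⟩, Or.inl h2]
            · rintro (rfl | ⟨h1, h2⟩)
              exacts [⟨hmem, Or.inr rfl⟩, ⟨h1, Or.inl h2⟩]
          rw [this, Finset.card_insert_of_notMem (by simp)]
          simpa [State.setVar, Expr.eval] using hcnt
        · intro _
          exact ⟨k, hmem, by simpa [State.setVar, Expr.eval] using hk⟩
    · exact Runs.skip (by decide) (hskip fun h => hadj.2 (mem_uncovered.1 h).1 he)
  · rw [h.2.2.1]
    congr 1
    exact Finset.filter_true_of_mem fun a _ => a.2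

/-- After the vertices below `k` have been scanned, variables `7`, `8`, `9` hold the best candidate
among them. -/
def IsBest (G : SimpleGraph (Fin n)) (B : Set (Fin n)) (L : List (Fin n × Fin n)) (k : ℕ)
    (s : State) : Prop :=
  (s.var 7 = 0 ∧ ∀ c ∈ B, (c : ℕ) < k → G.uncovered L c = ∅) ∨
    ∃ b ∈ B, ∃ a ∈ G.uncovered L b, s.var 7 = (G.uncovered L b).card ∧ s.var 8 = b ∧ s.var 9 = a ∧
      ∀ c ∈ B, (c : ℕ) < k → (G.uncovered L c).Nonempty →
        (G.uncovered L b).card ≤ (G.uncovered L c).card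

theorem IsBest.congr {k : ℕ} {s s' : State} (h : IsBest G B L k s) (h7 : s'.var 7 = s.var 7)
    (h8 : s'.var 8 = s.var 8) (h9 : s'.var 9 = s.var 9) : IsBest G B L k s' := by
  unfold IsBest
  rw [h7, h8, h9]
  exact h

theorem IsBest.succ {k : Fin n} {s : State} (h : IsBest G B L k s)
    (hk : k ∈ B → (G.uncovered L k).Nonempty →
      s.var 7 ≠ 0 ∧ s.var 7 ≤ (G.uncovered L k).card) : IsBest G B L (k + 1) s := by
  rcases h with ⟨h7, h⟩ | ⟨b, hb, a, ha, h7, h8, h9, h⟩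
  · refine Or.inl ⟨h7, fun c hc hck => ?_⟩
    rcases Nat.lt_succ_iff_lt_or_eq.1 hck with hck | hck
    · exact h c hc hck
    · obtain rfl : c = k := Fin.ext hck
      by_contra hne
      exact (hk hc (Finset.nonempty_iff_ne_empty.2 hne)).1 h7
  · refine Or.inr ⟨b, hb, a, ha, h7, h8, h9, fun c hc hck hne => ?_⟩
    rcases Nat.lt_succ_iff_lt_or_eq.1 hck with hck | hck
    · exact h c hc hck hne
    · obtain rfl : c = k := Fin.ext hck
      exact h7 ▸ (hk hc hne).2

theorem runs_compareProg {s : State} {k : Fin n} (hkB : k ∈ B) (hk : s.var 2 = k)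
    (h5 : s.var 5 = (G.uncovered L k).card)
    (h6 : s.var 5 ≠ 0 → ∃ a ∈ G.uncovered L k, s.var 6 = a) (hbest : IsBest G B L k s) :
    Runs compareProg s 20 fun s' => s'.arr = s.arr ∧ (∀ y < 7, s'.var y = s.var y) ∧
      IsBest G B L (k + 1) s' := by
  unfold compareProg
  refine Runs.cond (T' := 18) (by simp [Expr.cost]) (fun he => ?_) (fun he => ?_)
  · have he : s.var 5 ≠ 0 := he
    obtain ⟨a, ha, h6⟩ := h6 he
    refine Runs.cond (T' := 9) (by simp [Expr.cost]) (fun hc => ?_) (fun hc => ?_)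
    · refine Runs.seq (T₁ := 2) (T₂ := 4) (Runs.assign (by simp [Expr.cost]) ?_) (by decide)
      refine Runs.seq (T₁ := 2) (T₂ := 2) (Runs.assign (by simp [Expr.cost]) ?_) (by decide)
      refine Runs.assign (by simp [Expr.cost]) ⟨rfl, fun y hy => ?_, ?_⟩
      · have e7 : y ≠ 7 := by omega
        have e8 : y ≠ 8 := by omega
        have e9 : y ≠ 9 := by omega
        simp [State.setVar, e7, e8, e9]
      · refine Or.inr ⟨k, hkB, a, ha, ?_, ?_, ?_, fun c hcB hck hne => ?_⟩
        · simpa [State.setVar, Expr.eval] using h5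
        · simpa [State.setVar, Expr.eval] using hk
        · simpa [State.setVar, Expr.eval] using h6
        · rcases Nat.lt_succ_iff_lt_or_eq.1 hck with hck | hck
          · rcases hbest with ⟨-, h⟩ | ⟨b, hb, a', ha', h7, -, -, h⟩
            · exact absurd (h c hcB hck) hne.ne_empty
            · have h1 := h c hcB hck hne
              have h2 : s.var 5 < s.var 7 := by
                by_contra hlt
                have h3 : s.var 7 ≠ 0 := by
                  rw [h7]
                  exact (Finset.card_pos.2 ⟨a', ha'⟩).ne'
                simp [Expr.eval, hlt, h3] at hc
              omega
          · rw [show c = k from Fin.ext hck]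
    · refine Runs.skip (by decide) ⟨rfl, fun _ _ => rfl, hbest.succ fun _ _ => ?_⟩
      rw [← h5]
      have hc : (if s.var 7 = 0 then 1 else 0) + (if s.var 5 < s.var 7 then 1 else 0) = 0 := hc
      exact ⟨fun h => by simp [h] at hc, not_lt.1 fun h => by simp [h] at hc⟩
  · have he : s.var 5 = 0 := he
    refine Runs.skip (by decide) ⟨rfl, fun _ _ => rfl, hbest.succ fun _ hne => ?_⟩
    have := Finset.card_pos.2 hne
    omega

theorem runs_scanProg {s : State} (hG : HasGraph G s) (hn : s.var 0 = n)
    (hB : flagged n 2 s = B) (hcov : flagged n 3 s = G.covered L) :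
    Runs scanProg s (n * (n * 24 + 40) + 8) fun s' => s'.arr = s.arr ∧
      (∀ y < 2, s'.var y = s.var y) ∧ IsBest G B L n s' := by
  unfold scanProg
  refine Runs.seq (T₁ := 2) (T₂ := n * (n * 24 + 40) + 6) (Runs.assign (by simp [Expr.cost]) ?_)
    (by omega)
  refine Runs.forLoop (s := s.setVar 7 0) (fun k s' => s'.arr = s.arr ∧ (∀ y < 2, s'.var y = s.var y) ∧
      IsBest G B L k s')
    (by decide) (by exact hn) ⟨rfl, fun y hy => ?_, ?_⟩ ?_ (T := n * 24 + 32)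
    le_rfl (fun s' _ h => h)
  · have e2 : y ≠ 2 := by omega
    have e7 : y ≠ 7 := by omega
    simp [State.setVar, e2, e7]
  · exact Or.inl ⟨by simp [State.setVar], by simp⟩
  · rintro k s' h0 hk ⟨harr, hvar, hbest⟩
    have hG' : HasGraph G s' := by
      intro i j
      rw [harr]
      exact hG i j
    have hflag : ∀ a, flagged n a s' = flagged n a s := fun a => by
      unfold flagged
      rw [harr]
    have hset : ∀ (s₂ : State) (v y : ℕ), y < 2 → (s₂.setVar 2 v).var y = s₂.var y :=
      fun _ _ y hy => if_neg (by omega)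
    have hkB : (Expr.get 2 (.var 2) (.const 0)).eval s' ≠ 0 ↔ k ∈ B := by
      simp only [Expr.eval, hk]
      rw [← mem_flagged, hflag, hB]
    refine Runs.cond (T' := n * 24 + 28) (by simp [Expr.cost]; omega) (fun he => ?_) (fun he => ?_)
    · rw [hkB] at he
      refine Runs.seq (T₁ := n * 24 + 8) (T₂ := 20) ?_ le_rfl
      refine (runs_countProg hG' h0 hk (by rw [hflag, hcov])).mono le_rfl ?_
      rintro s₁ ⟨harr₁, hvar₁, h5, h6⟩
      have hk₁ : s₁.var 2 = k := (hvar₁ 2 (by decide) (by decide) (by decide)).trans hk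
      refine (runs_compareProg he hk₁ h5 h6 (hbest.congr ?_ ?_ ?_)).mono le_rfl ?_
      iterate 3 exact hvar₁ _ (by decide) (by decide) (by decide)
      rintro s₂ ⟨harr₂, hvar₂, hbest₂⟩
      have hvar₃ : ∀ y < 3, s₂.var y = s'.var y := fun y hy =>
        (hvar₂ y (by omega)).trans (hvar₁ y (by omega) (by omega) (by omega))
      refine ⟨(hvar₃ 0 (by decide)).trans h0, (hvar₃ 2 (by decide)).trans hk,
        harr₂.trans (harr₁.trans harr), fun y hy => ?_, hbest₂.congr rfl rfl rfl⟩
      rw [hset _ _ y hy, hvar₃ y (by omega), hvar y hy]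
    · refine Runs.skip (by omega) ⟨h0, hk, harr, fun y hy => ?_, ?_⟩
      · rw [hset _ _ y hy, hvar y hy]
      · exact (hbest.succ fun h => absurd he (hkB.2 h)).congr rfl rfl rfl

/-- Array `1` holds the adjacency matrix of the set of edges in `L`. -/
def HoldsEdges (L : List (Fin n × Fin n)) (s : State) : Prop :=
  ∀ i j : Fin n, ((i, j) ∈ L ∨ (j, i) ∈ L → s.arr 1 i j = 1) ∧
    (¬ ((i, j) ∈ L ∨ (j, i) ∈ L) → s.arr 1 i j = 0)

theorem runs_pickProg {s : State} {b a : Fin n} (hG : HasGraph G s) (hn : s.var 0 = n)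
    (h8 : s.var 8 = b) (h9 : s.var 9 = a) (hcov : flagged n 3 s = G.covered L)
    (hout : HoldsEdges L s) :
    Runs pickProg s (n * 16 + 14) fun s' => (∀ y, y ≠ 3 → s'.var y = s.var y) ∧
      s'.arr 0 = s.arr 0 ∧ s'.arr 2 = s.arr 2 ∧
      flagged n 3 s' = G.covered ((b, a) :: L) ∧ HoldsEdges ((b, a) :: L) s' := by
  unfold pickProg
  refine Runs.seq (T₁ := 4) (T₂ := n * 16 + 10) (Runs.put (by simp [Expr.cost]) ?_) (by omega)
  refine Runs.seq (T₁ := 4) (T₂ := n * 16 + 6) (Runs.put (by simp [Expr.cost]) ?_) (by omega)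
  simp only [Expr.eval, State.setArr, h8, h9]
  refine Runs.forLoop (fun k s' => (∀ y, y ≠ 3 → s'.var y = s.var y) ∧
      s'.arr 0 = s.arr 0 ∧ s'.arr 2 = s.arr 2 ∧ HoldsEdges ((b, a) :: L) s' ∧
      ∀ x : Fin n, x ∈ flagged n 3 s' ↔ x ∈ G.covered L ∨ (x : ℕ) < k ∧ G.Adj b x)
    (by decide) (by exact hn) ⟨?_, ?_, ?_, ?_, ?_⟩ ?_ (T := 8) le_rfl
    (fun s' _ h => ⟨h.1, h.2.1, h.2.2.1, ?_, h.2.2.2.1⟩)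
  · intro y hy
    simp [State.setVar, hy]
  · rfl
  · rfl
  · intro i j
    have := hout i j
    simp only [State.setVar, List.mem_cons, Prod.mk.injEq, true_and, Fin.val_inj]
    split_ifs <;> grind
  · intro x
    rw [← Finset.mem_coe, ← hcov]
    simp [mem_flagged, State.setVar]
  · rintro k s' h0 hk ⟨hvar, h0', h2', hedges, hcov'⟩
    have hadj : (Expr.get 0 (.var 8) (.var 3)).eval s' ≠ 0 ↔ G.Adj b k := by
      simp only [Expr.eval, hk, h0', hvar 8 (by decide), h8]
      exact hG b k
    refine Runs.cond (T' := 4) (by simp [Expr.cost]) (fun he => ?_) (fun he => ?_)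
    · rw [hadj] at he
      refine Runs.put (by simp [Expr.cost]) ?_
      simp only [Expr.eval, hk]
      refine ⟨h0, hk, fun y hy => ?_, ?_, ?_, ?_, fun x => ?_⟩
      · simpa [State.setVar, State.setArr, hy] using hvar y hy
      · rw [← h0']
        rfl
      · rw [← h2']
        rfl
      · exact hedges
      · rw [flagged_setVar, flagged_setArr, Set.mem_insert_iff, hcov']
        have : (x : ℕ) = k ↔ x = k := Fin.val_inj
        rw [Nat.lt_succ_iff_lt_or_eq, this]
        constructor
        · rintro (rfl | h | h)
          exacts [Or.inr ⟨Or.inr rfl, he⟩, Or.inl h, Or.inr ⟨Or.inl h.1, h.2⟩]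
        · tauto
    · refine Runs.skip (by decide) ⟨h0, hk, fun y hy => ?_, h0', h2', hedges, fun x => ?_⟩
      · simpa [State.setVar, hy] using hvar y hy
      · rw [flagged_setVar, hcov', Nat.lt_succ_iff_lt_or_eq]
        have : (x : ℕ) = k → ¬ G.Adj b x := fun h h' => hadj.2 (Fin.ext h ▸ h') he
        tauto
  · ext x
    rw [h.2.2.2.2 x, Finset.mem_coe, mem_covered, mem_covered]
    simp [or_comm]

/-- The number of operations of `greedyProg` on `n` vertices is at most the value of this polynomial
at `n`. -/
noncomputable def timeBound : Polynomial ℕ :=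
  .X * (.X * (.X * (.X * 16 + 18) + 18) + 14) + 10 + (.X * (.X * (.X * 24 + 40) + .X * 16 + 32) + 6)

theorem runs_greedyProg (hcl : ∀ i ∈ B, ∀ j l, G.Adj i j → G.Adj j l → l ∈ B) (hpos : 0 < n)
    (h0B : ⟨0, hpos⟩ ∈ B)
    (hB : ∀ b ∈ B, ∃ (r : ℕ) (p : G.Walk ⟨0, hpos⟩ b), p.length = 2 * r ∧ r ≤ n)
    [DecidableRel G.Adj] :
    Runs greedyProg (inputState G) (timeBound.eval n) fun s =>
      ∃ L, G.IsGreedyRun B L ∧ (∀ b ∈ B, G.uncovered L b = ∅) ∧ HoldsEdges L s := by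
  have hG : HasGraph G (inputState G) := by
    intro i j
    simp [inputState]
  have harr : ∀ a ≠ 0, ∀ i j, (inputState G).arr a i j = 0 := by
    intro a ha i j
    simp [inputState, ha]
  unfold greedyProg
  refine Runs.seq (T₁ := n * (n * (n * (n * 16 + 18) + 18) + 14) + 10)
    (T₂ := n * (n * (n * 24 + 40) + n * 16 + 32) + 6) ?_ (by simp [timeBound])
  refine (runs_markProg hcl hpos h0B hB hG (by simp [inputState]) ?_).mono le_rfl ?_
  · ext i
    simp [mem_flagged, harr]
  rintro s ⟨hn, hs, hflag⟩
  have hGs : HasGraph G s := by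
    intro i j
    rw [hs 0 (by decide)]
    exact hG i j
  refine Runs.forLoop (fun k s' => s'.arr 0 = s.arr 0 ∧ s'.arr 2 = s.arr 2 ∧
      ∃ L, G.IsGreedyRun B L ∧ (k ≤ L.length ∨ ∀ b ∈ B, G.uncovered L b = ∅) ∧
        flagged n 3 s' = G.covered L ∧ HoldsEdges L s')
    (by decide) hn ⟨rfl, rfl, [], .nil, Or.inl le_rfl, ?_, ?_⟩ ?_
    (T := n * (n * 24 + 40) + n * 16 + 24) le_rfl ?_
  · ext i
    simp [mem_flagged, covered, State.setVar, hs, harr]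
  · intro i j
    simp [State.setVar, hs, harr]
  · rintro k s' h0 hk ⟨ha0, ha2, L, hL, hlen, hcov, hout⟩
    have hG' : HasGraph G s' := by
      intro i j
      rw [ha0]
      exact hGs i j
    have hB' : flagged n 2 s' = B := by
      rw [← hflag]
      unfold flagged
      rw [ha2]
    refine Runs.seq (T₁ := n * (n * 24 + 40) + 8) (T₂ := n * 16 + 16) ?_ (by omega)
    refine (runs_scanProg hG' h0 hB' hcov).mono le_rfl ?_
    rintro s₁ ⟨harr₁, hvar₁, hbest⟩
    have hG₁ : HasGraph G s₁ := by
      intro i j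
      rw [harr₁]
      exact hG' i j
    have hcov₁ : flagged n 3 s₁ = G.covered L := by
      rw [← hcov]
      unfold flagged
      rw [harr₁]
    have hout₁ : HoldsEdges L s₁ := by
      intro i j
      rw [harr₁]
      exact hout i j
    have h0₁ : s₁.var 0 = n := (hvar₁ 0 (by decide)).trans h0
    have hk₁ : s₁.var 1 = k := (hvar₁ 1 (by decide)).trans hk
    refine Runs.cond (T' := n * 16 + 14) (by simp [Expr.cost]; omega) (fun he => ?_) (fun he => ?_)
    · have he : s₁.var 7 ≠ 0 := he
      obtain ⟨b, hb, a, ha, -, h8, h9, hmin⟩ := hbest.resolve_left fun h => he h.1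
      refine (runs_pickProg hG₁ h0₁ h8 h9 hcov₁ hout₁).mono le_rfl ?_
      rintro s₂ ⟨hvar₂, h0', h2', hcov₂, hout₂⟩
      refine ⟨(hvar₂ 0 (by decide)).trans h0₁, (hvar₂ 1 (by decide)).trans hk₁, ?_, ?_,
        (b, a) :: L, .cons hL hb ha fun c hc => hmin c hc c.2, Or.inl ?_, hcov₂, hout₂⟩
      · exact h0'.trans ((congrFun harr₁ 0).trans ha0)
      · exact h2'.trans ((congrFun harr₁ 2).trans ha2)
      · rcases hlen with h | h
        · simpa using h
        · rw [h b hb] at ha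
          simp at ha
    · have he : s₁.var 7 = 0 := he
      refine Runs.skip (by omega) ⟨h0₁, hk₁, (congrFun harr₁ 0).trans ha0,
        (congrFun harr₁ 2).trans ha2, L, hL, Or.inr fun c hc => ?_, hcov₁, hout₁⟩
      rcases hbest with ⟨-, h⟩ | ⟨b, hb, a, ha, h7, -⟩
      · exact h c hc c.2
      · rw [he] at h7
        exact absurd h7.symm (Finset.card_pos.2 ⟨a, ha⟩).ne'
  · rintro s' - ⟨-, -, L, hL, hlen, -, hout⟩
    refine ⟨L, hL, ?_, hout⟩
    rcases hlen with h | h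
    · -- Every step covers a new vertex, so after `n` steps all vertices are covered.
      have hall : G.covered L = Finset.univ := by
        rw [← Finset.card_eq_iff_eq_univ, Fintype.card_fin]
        refine le_antisymm ?_ (h.trans hL.length_le_card_covered)
        simpa using Finset.card_le_univ (G.covered L)
      intro b _
      rw [Finset.eq_empty_iff_forall_notMem]
      intro a ha
      exact (mem_uncovered.1 ha).2 (hall ▸ Finset.mem_univ a)
    · exact h

end RAM

/-! ### The approximation ratio of the program -/

theorem theorem1 (Δ : ℕ) (hΔ : 3 ≤ Δ) :
    ∃ (P : RAM.Prog) (p : Polynomial ℕ),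
      ∀ (n : ℕ) (G : SimpleGraph (Fin n)) [DecidableRel G.Adj],
        G.Connected → G.IsBipartite → (SimpleGraph.cycleGraph 4).Free G → G.maxDegree ≤ Δ →
          ∃ (t : ℕ) (s : RAM.State) (M : G.Subgraph),
            RAM.Exec P (RAM.inputState G) t s ∧ t ≤ p.eval n ∧
            s.Outputs M ∧ SimpleGraph.IsUniquelyRestricted M ∧
            ((((Δ : ℚ) - 1) ^ 2 + ((Δ : ℚ) - 2)) / (((Δ : ℚ) - 1) ^ 3 + ((Δ : ℚ) - 2))) *
              (G.urMatchingNumber : ℚ) ≤ (M.edgeSet.ncard : ℚ) := by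
  refine ⟨RAM.greedyProg, RAM.timeBound, fun n G _ hconn hbip h4 hdeg => ?_⟩
  have hpos : 0 < n := by
    obtain ⟨v⟩ := hconn.nonempty
    exact v.pos
  let c : G.Coloring Bool := SimpleGraph.recolorOfEquiv G finTwoEquiv hbip.some
  let B : Set (Fin n) := {v | c v = c ⟨0, hpos⟩}
  have hB : ∀ u v, G.Adj u v → (u ∈ B ↔ v ∉ B) := by
    intro u v huv
    have := c.valid huv
    change c u = c _ ↔ ¬ c v = c _
    revert this
    cases c u <;> cases c v <;> cases c ⟨0, hpos⟩ <;> decide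
  have hdist : ∀ b ∈ B, ∃ (r : ℕ) (p : G.Walk ⟨0, hpos⟩ b), p.length = 2 * r ∧ r ≤ n := by
    intro b hb
    obtain ⟨p, hp⟩ := (hconn.preconnected ⟨0, hpos⟩ b).exists_isPath
    have hb : c b = c ⟨0, hpos⟩ := hb
    obtain ⟨r, hr⟩ := (c.even_length_iff_congr p).2 (by rw [hb])
    have hlt := hp.length_lt
    rw [Fintype.card_fin] at hlt
    exact ⟨r, p, by omega, by omega⟩
  obtain ⟨t, s, hexec, ht, L, hL, hdone, hout⟩ := RAM.runs_greedyProg (G := G)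
    (fun i hi j l hij hjl => (hB _ _ hjl.symm).2 ((hB _ _ hij).1 hi)) hpos rfl hdist
  refine ⟨t, s, hL.matching, hexec, ht, hout, hL.isUniquelyRestricted hB, ?_⟩
  refine (hL.ratio_mul_urMatchingNumber_le hconn hB h4 hΔ (fun v => ?_) hdone).trans
    (by exact_mod_cast hL.length_le_ncard_edgeSet hB)
  rw [Set.ncard_eq_toFinset_card', Set.toFinset_card, SimpleGraph.card_neighborSet_eq_degree]
  exact (G.degree_le_maxDegree v).trans hdeg
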